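/- Let $q\in\mathbb{C}^\times$ be not a root of unity. Let $\mathcal{O}_q(\mathrm{Mat}_2)$ be the bialgebra generated over $\mathbb{C}$ by $a,b,c,d$ with relations $$ab=qba,\quad ac=qca,\quad bc=cb,\quad bd=qdb,\quad cd=qdc,\quad ad-da=(q-q^{-1})bc,$$ with coproduct $\Delta(a)=a\otimes a+b\otimes c$, $\Delta(b)=a\otimes b+b\otimes d$, $\Delta(c)=c\otimes a+d\otimes c$, $\Delta(d)=c\otimes b+d\otimes d$ and counit $\epsilon(a)=\epsilon(d)=1$, $\epsilon(b)=\epsilon(c)=0$. Let $D_q=ad-qbc$ be the quantum determinant, and let $\mathcal{O}_q(\mathrm{SL}_2)=\mathcal{O}_q(\mathrm{Mat}_2)/\langle D_q-1\rangle$ with the induced bialgebra structure. Let $U_q(\mathfrak{sl}_2)$ be generated by $E,F,K^{\pm1}$ with $KE=q^2EK$, $KF=q^{-2}FK$, $EF-FE=\frac{K-K^{-1}}{q-q^{-1}}$, and with coproduct $\Delta(E)=E\otimes1+K\otimes E$, $\Delta(F)=F\otimes K^{-1}+1\otimes F$, $\Delta(K)=K\otimes K$ and counit $\epsilon(E)=\epsilon(F)=0$,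 $\epsilon(K)=1$. Let $\mathcal{V}_m$ be its irreducible type $1$ module of highest weight $m\ge0$ (of dimension $m+1$). Identify $\mathcal{O}_q(\mathrm{SL}_2)$ with the algebra of matrix coefficients of the modules $\mathcal{V}_m$, inside the dual of $U_q(\mathfrak{sl}_2)$ with the convolution product, by sending $a,b,c,d$ to the four matrix coefficients of $\mathcal{V}_1$ in its standard basis. For an integer $n$, let $\mathcal{O}_q(\mathrm{SL}_2)_{\le n}$ be the subspace of $\mathcal{O}_q(\mathrm{SL}_2)$ that corresponds to the span of the matrix coefficients of the modules $\mathcal{V}_m$ with $0\le m\le n$ and $m\equiv n \bmod 2$ (the Peter–Weyl filtration). Let $z$ be a central variable, and give $\mathcal{O}_q(\mathrm{SL}_2)[z]$ the bialgebra structure with $\Delta(fz^n)=\Delta(f)\cdot(z^n\otimes z^n)$ and $\epsilon(fz^n)=\epsilon(f)$. Then the quantum Vinberg semigroup for $\mathrm{SL}_2$, $$\mathcal{O}_q(\mathbb{V}_{\mathrm{SL}_2})=\bigoplus_{n\ge0}\mathcal{O}_q(\mathrm{SL}_2)_{\le n}\,z^n ,$$ is a sub-bialgebra of $\mathcal{O}_q(\mathrm{SL}_2)[z]$,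 and there is an isomorphism of bialgebras $\mathcal{O}_q(\mathbb{V}_{\mathrm{SL}_2})\simeq\mathcal{O}_q(\mathrm{Mat}_2)$ under which $z^2$ corresponds to $D_q$. -/

import Mathlib

open scoped TensorProduct

noncomputable section

namespace QuantumSL2

/-! ### The quantum matrix algebra -/

/-- The generators of the quantum `2 × 2` matrix algebra. -/
inductive MatGen : Type
  | a | b | c | d

open MatGen in
/-- The defining relations of the quantum `2 × 2` matrix algebra. -/
inductive MatRel (q : ℂˣ) : FreeAlgebra ℂ MatGen → FreeAlgebra ℂ MatGen → Prop
  | ab : MatRel q (.ι ℂ a * .ι ℂ b) ((q : ℂ) • (.ι ℂ b * .ι ℂ a))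
  | ac : MatRel q (.ι ℂ a * .ι ℂ c) ((q : ℂ) • (.ι ℂ c * .ι ℂ a))
  | bc : MatRel q (.ι ℂ b * .ι ℂ c) (.ι ℂ c * .ι ℂ b)
  | bd : MatRel q (.ι ℂ b * .ι ℂ d) ((q : ℂ) • (.ι ℂ d * .ι ℂ b))
  | cd : MatRel q (.ι ℂ c * .ι ℂ d) ((q : ℂ) • (.ι ℂ d * .ι ℂ c))
  | ad : MatRel q (.ι ℂ a * .ι ℂ d - .ι ℂ d * .ι ℂ a)
      (((q : ℂ) - (q : ℂ)⁻¹) • (.ι ℂ b * .ι ℂ c))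

/-- The quantum `2 × 2` matrix algebra `O_q(Mat₂)`. -/
def OqMat2 (q : ℂˣ) : Type := RingQuot (MatRel q)

instance (q : ℂˣ) : Ring (OqMat2 q) := inferInstanceAs (Ring (RingQuot (MatRel q)))

instance (q : ℂˣ) : Algebra ℂ (OqMat2 q) := inferInstanceAs (Algebra ℂ (RingQuot (MatRel q)))

namespace OqMat2

variable {q : ℂˣ}

/-- The quotient map from the free algebra. -/
def mk (q : ℂˣ) : FreeAlgebra ℂ MatGen →ₐ[ℂ] OqMat2 q := RingQuot.mkAlgHom ℂ (MatRel q)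

theorem mk_rel {x y : FreeAlgebra ℂ MatGen} (h : MatRel q x y) : mk q x = mk q y :=
  RingQuot.mkAlgHom_rel ℂ h

/-- The class of a generator in `O_q(Mat₂)`. -/
def gen (q : ℂˣ) (x : MatGen) : OqMat2 q := mk q (.ι ℂ x)

/-- The generator `a` of `O_q(Mat₂)`. -/
abbrev a (q : ℂˣ) : OqMat2 q := gen q .a
/-- The generator `b` of `O_q(Mat₂)`. -/
abbrev b (q : ℂˣ) : OqMat2 q := gen q .b
/-- The generator `c` of `O_q(Mat₂)`. -/
abbrev c (q : ℂˣ) : OqMat2 q := gen q .c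
/-- The generator `d` of `O_q(Mat₂)`. -/
abbrev d (q : ℂˣ) : OqMat2 q := gen q .d

theorem a_mul_b : a q * b q = (q : ℂ) • (b q * a q) := by
  simpa [gen] using mk_rel (MatRel.ab (q := q))

theorem a_mul_c : a q * c q = (q : ℂ) • (c q * a q) := by
  simpa [gen] using mk_rel (MatRel.ac (q := q))

theorem c_mul_b : c q * b q = b q * c q := by
  simpa [gen] using (mk_rel (MatRel.bc (q := q))).symm

theorem b_mul_d : b q * d q = (q : ℂ) • (d q * b q) := by
  simpa [gen] using mk_rel (MatRel.bd (q := q))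

theorem c_mul_d : c q * d q = (q : ℂ) • (d q * c q) := by
  simpa [gen] using mk_rel (MatRel.cd (q := q))

theorem a_mul_d : a q * d q = d q * a q + ((q : ℂ) - (q : ℂ)⁻¹) • (b q * c q) := by
  have h : a q * d q - d q * a q = ((q : ℂ) - (q : ℂ)⁻¹) • (b q * c q) := by
    simpa [gen] using mk_rel (MatRel.ad (q := q))
  rw [← h]; abel

/-- Algebra homomorphisms out of `O_q(Mat₂)` are determined by the images of the generators. -/
theorem hom_ext {B : Type*} [Semiring B] [Algebra ℂ B] {f g : OqMat2 q →ₐ[ℂ] B}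
    (h : ∀ x, f (gen q x) = g (gen q x)) : f = g := by
  apply RingQuot.ringQuot_ext'
  apply FreeAlgebra.hom_ext
  funext x
  exact h x

/-- The universal property of `O_q(Mat₂)`. -/
def lift {B : Type*} [Ring B] [Algebra ℂ B] (f : MatGen → B)
    (hab : f .a * f .b = (q : ℂ) • (f .b * f .a))
    (hac : f .a * f .c = (q : ℂ) • (f .c * f .a))
    (hbc : f .b * f .c = f .c * f .b)
    (hbd : f .b * f .d = (q : ℂ) • (f .d * f .b))
    (hcd : f .c * f .d = (q : ℂ) • (f .d * f .c))
    (had : f .a * f .d - f .d * f .a = ((q : ℂ) - (q : ℂ)⁻¹) • (f .b * f .c)) :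
    OqMat2 q →ₐ[ℂ] B :=
  RingQuot.liftAlgHom ℂ ⟨FreeAlgebra.lift ℂ f, by
    intro x y h
    cases h <;> simp only [map_mul, map_smul, map_sub, FreeAlgebra.lift_ι_apply] <;> assumption⟩

@[simp]
theorem lift_gen {B : Type*} [Ring B] [Algebra ℂ B] (f : MatGen → B)
    (hab hac hbc hbd hcd had) (x : MatGen) :
    lift (q := q) f hab hac hbc hbd hcd had (gen q x) = f x := by
  exact (RingQuot.liftAlgHom_mkAlgHom_apply ℂ (FreeAlgebra.lift ℂ f) _ (.ι ℂ x)).trans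
    (FreeAlgebra.lift_ι_apply f x)

/-- The values of the coproduct on the generators. -/
def comulGen (q : ℂˣ) : MatGen → OqMat2 q ⊗[ℂ] OqMat2 q
  | .a => a q ⊗ₜ a q + b q ⊗ₜ c q
  | .b => a q ⊗ₜ b q + b q ⊗ₜ d q
  | .c => c q ⊗ₜ a q + d q ⊗ₜ c q
  | .d => c q ⊗ₜ b q + d q ⊗ₜ d q

/-- The values of the counit on the generators. -/
def counitGen : MatGen → ℂ
  | .a => 1
  | .b => 0
  | .c => 0
  | .d => 1

/-- The coproduct of `O_q(Mat₂)`. -/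
def comul (q : ℂˣ) : OqMat2 q →ₐ[ℂ] OqMat2 q ⊗[ℂ] OqMat2 q := by
  refine lift (comulGen q) ?_ ?_ ?_ ?_ ?_ (sub_eq_iff_eq_add.2 ?_) <;>
  · simp only [comulGen, add_mul, mul_add, Algebra.TensorProduct.tmul_mul_tmul, a_mul_b, a_mul_c,
      c_mul_b, b_mul_d, c_mul_d, a_mul_d, TensorProduct.tmul_add, TensorProduct.add_tmul,
      TensorProduct.tmul_smul, ← TensorProduct.smul_tmul', smul_add, smul_smul]
    have hq : (q : ℂ) ≠ 0 := q.ne_zero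
    match_scalars <;> field_simp <;> ring

/-- The counit of `O_q(Mat₂)`. -/
def counit (q : ℂˣ) : OqMat2 q →ₐ[ℂ] ℂ := by
  refine lift counitGen ?_ ?_ ?_ ?_ ?_ ?_ <;> simp [counitGen]

@[simp]
theorem comul_gen (x : MatGen) : comul q (gen q x) = comulGen q x := by
  simp [comul]

@[simp]
theorem counit_gen (x : MatGen) : counit q (gen q x) = counitGen x := by
  simp [counit]

instance : Bialgebra ℂ (OqMat2 q) :=
  Bialgebra.ofAlgHom (comul q) (counit q)
    (by
      apply hom_ext
      rintro (_ | _ | _ | _) <;>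
        simp [comulGen, TensorProduct.tmul_add, TensorProduct.add_tmul] <;> abel)
    (by apply hom_ext; rintro (_ | _ | _ | _) <;> simp [comulGen, counitGen])
    (by apply hom_ext; rintro (_ | _ | _ | _) <;> simp [comulGen, counitGen])

/-- The quantum determinant `D_q = ad - q bc`. -/
def qdet (q : ℂˣ) : OqMat2 q := a q * d q - (q : ℂ) • (b q * c q)

theorem comul_qdet : comul q (qdet q) = qdet q ⊗ₜ qdet q := by
  have h : qdet q = a q * d q + (-(q : ℂ)) • (b q * c q) := by
    rw [qdet, neg_smul, sub_eq_add_neg]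
  simp only [h, map_add, map_mul, map_smul, comul_gen, comulGen, add_mul, mul_add,
    Algebra.TensorProduct.tmul_mul_tmul, a_mul_c, c_mul_b, b_mul_d, a_mul_d,
    TensorProduct.tmul_add,
    TensorProduct.add_tmul, TensorProduct.tmul_smul, ← TensorProduct.smul_tmul', smul_add,
    smul_smul]
  have hq : (q : ℂ) ≠ 0 := q.ne_zero
  match_scalars <;> field_simp <;> ring

theorem counit_qdet : counit q (qdet q) = 1 := by
  simp [qdet, counitGen]

end OqMat2

/-! ### The quantum coordinate algebra of `SL₂` -/

/-- The relation imposing that the quantum determinant equals `1`. -/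
inductive DetRel (q : ℂˣ) : OqMat2 q → OqMat2 q → Prop
  | det : DetRel q (OqMat2.qdet q) 1

/-- The quantum coordinate algebra `O_q(SL₂)`: the quotient of `O_q(Mat₂)` by the two-sided ideal
generated by `D_q - 1`. -/
def OqSL2 (q : ℂˣ) : Type := RingQuot (DetRel q)

instance (q : ℂˣ) : Ring (OqSL2 q) := inferInstanceAs (Ring (RingQuot (DetRel q)))

instance (q : ℂˣ) : Algebra ℂ (OqSL2 q) := inferInstanceAs (Algebra ℂ (RingQuot (DetRel q)))

namespace OqSL2

variable {q : ℂˣ}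

/-- The quotient map `O_q(Mat₂) → O_q(SL₂)`. -/
def mk (q : ℂˣ) : OqMat2 q →ₐ[ℂ] OqSL2 q := RingQuot.mkAlgHom ℂ (DetRel q)

theorem mk_qdet : mk q (OqMat2.qdet q) = 1 := by
  have h : mk q (OqMat2.qdet q) = mk q 1 := RingQuot.mkAlgHom_rel ℂ DetRel.det
  rw [h, map_one]

/-- Algebra homomorphisms out of `O_q(SL₂)` are determined by the images of the generators. -/
theorem hom_ext {B : Type*} [Semiring B] [Algebra ℂ B] {f g : OqSL2 q →ₐ[ℂ] B}
    (h : ∀ x, f (mk q (OqMat2.gen q x)) = g (mk q (OqMat2.gen q x))) : f = g := by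
  apply RingQuot.ringQuot_ext'
  apply OqMat2.hom_ext
  exact h

/-- The universal property of `O_q(SL₂)`. -/
def lift {B : Type*} [Ring B] [Algebra ℂ B] (f : OqMat2 q →ₐ[ℂ] B)
    (hf : f (OqMat2.qdet q) = 1) : OqSL2 q →ₐ[ℂ] B :=
  RingQuot.liftAlgHom ℂ ⟨f, by rintro _ _ ⟨⟩; rw [hf, map_one]⟩

@[simp]
theorem lift_mk {B : Type*} [Ring B] [Algebra ℂ B] (f : OqMat2 q →ₐ[ℂ] B)
    (hf : f (OqMat2.qdet q) = 1) (x : OqMat2 q) : lift f hf (mk q x) = f x := by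
  exact RingQuot.liftAlgHom_mkAlgHom_apply ℂ f _ x

/-- The coproduct of `O_q(SL₂)`, induced by that of `O_q(Mat₂)`. -/
def comul (q : ℂˣ) : OqSL2 q →ₐ[ℂ] OqSL2 q ⊗[ℂ] OqSL2 q :=
  lift ((Algebra.TensorProduct.map (mk q) (mk q)).comp (OqMat2.comul q)) (by
    rw [AlgHom.comp_apply, OqMat2.comul_qdet, Algebra.TensorProduct.map_tmul, mk_qdet,
      Algebra.TensorProduct.one_def])

/-- The counit of `O_q(SL₂)`, induced by that of `O_q(Mat₂)`. -/
def counit (q : ℂˣ) : OqSL2 q →ₐ[ℂ] ℂ := lift (OqMat2.counit q) OqMat2.counit_qdet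

instance : Bialgebra ℂ (OqSL2 q) :=
  Bialgebra.ofAlgHom (comul q) (counit q)
    (by
      apply hom_ext
      rintro (_ | _ | _ | _) <;>
        simp [comul, OqMat2.comulGen, TensorProduct.tmul_add, TensorProduct.add_tmul] <;> abel)
    (by
      apply hom_ext
      rintro (_ | _ | _ | _) <;> simp [comul, counit, OqMat2.comulGen, OqMat2.counitGen])
    (by
      apply hom_ext
      rintro (_ | _ | _ | _) <;> simp [comul, counit, OqMat2.comulGen, OqMat2.counitGen])

end OqSL2

/-! ### The quantized enveloping algebra of `sl₂` -/

/-- The generators of `U_q(sl₂)`; `Kinv` stands for the inverse of `K`. -/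
inductive UGen : Type
  | E | F | K | Kinv

open UGen in
/-- The defining relations of `U_q(sl₂)`. -/
inductive URel (q : ℂˣ) : FreeAlgebra ℂ UGen → FreeAlgebra ℂ UGen → Prop
  | K_Kinv : URel q (.ι ℂ K * .ι ℂ Kinv) 1
  | Kinv_K : URel q (.ι ℂ Kinv * .ι ℂ K) 1
  | K_E : URel q (.ι ℂ K * .ι ℂ E) ((q : ℂ) ^ 2 • (.ι ℂ E * .ι ℂ K))
  | K_F : URel q (.ι ℂ K * .ι ℂ F) (((q : ℂ) ^ 2)⁻¹ • (.ι ℂ F * .ι ℂ K))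
  | E_F : URel q (.ι ℂ E * .ι ℂ F - .ι ℂ F * .ι ℂ E)
      (((q : ℂ) - (q : ℂ)⁻¹)⁻¹ • (.ι ℂ K - .ι ℂ Kinv))

/-- The quantized enveloping algebra `U_q(sl₂)`. -/
def Uq (q : ℂˣ) : Type := RingQuot (URel q)

instance (q : ℂˣ) : Ring (Uq q) := inferInstanceAs (Ring (RingQuot (URel q)))

instance (q : ℂˣ) : Algebra ℂ (Uq q) := inferInstanceAs (Algebra ℂ (RingQuot (URel q)))

namespace Uq

variable {q : ℂˣ}

/-- The quotient map from the free algebra. -/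
def mk (q : ℂˣ) : FreeAlgebra ℂ UGen →ₐ[ℂ] Uq q := RingQuot.mkAlgHom ℂ (URel q)

theorem mk_rel {x y : FreeAlgebra ℂ UGen} (h : URel q x y) : mk q x = mk q y :=
  RingQuot.mkAlgHom_rel ℂ h

theorem mk_surjective : Function.Surjective (mk q) := RingQuot.mkAlgHom_surjective ℂ (URel q)

/-- The class of a generator in `U_q(sl₂)`. -/
def gen (q : ℂˣ) (x : UGen) : Uq q := mk q (.ι ℂ x)

/-- The generator `E`. -/
abbrev E (q : ℂˣ) : Uq q := gen q .E
/-- The generator `F`. -/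
abbrev F (q : ℂˣ) : Uq q := gen q .F
/-- The generator `K`. -/
abbrev K (q : ℂˣ) : Uq q := gen q .K
/-- The generator `K⁻¹`. -/
abbrev Kinv (q : ℂˣ) : Uq q := gen q .Kinv

theorem K_mul_Kinv : K q * Kinv q = 1 := by simpa [gen] using mk_rel (URel.K_Kinv (q := q))

theorem Kinv_mul_K : Kinv q * K q = 1 := by simpa [gen] using mk_rel (URel.Kinv_K (q := q))

theorem K_mul_E : K q * E q = (q : ℂ) ^ 2 • (E q * K q) := by
  simpa [gen] using mk_rel (URel.K_E (q := q))

theorem K_mul_F : K q * F q = ((q : ℂ) ^ 2)⁻¹ • (F q * K q) := by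
  simpa [gen] using mk_rel (URel.K_F (q := q))

theorem Kinv_mul_E : Kinv q * E q = ((q : ℂ) ^ 2)⁻¹ • (E q * Kinv q) := by
  have hq : (q : ℂ) ^ 2 ≠ 0 := pow_ne_zero 2 q.ne_zero
  have h : Kinv q * (K q * E q) * Kinv q = (q : ℂ) ^ 2 • (Kinv q * E q) := by
    rw [K_mul_E, mul_smul_comm, smul_mul_assoc, mul_assoc, mul_assoc, K_mul_Kinv, mul_one]
  rw [← mul_assoc, Kinv_mul_K, one_mul] at h
  rw [h, smul_smul, inv_mul_cancel₀ hq, one_smul]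

theorem Kinv_mul_F : Kinv q * F q = (q : ℂ) ^ 2 • (F q * Kinv q) := by
  have hq : (q : ℂ) ^ 2 ≠ 0 := pow_ne_zero 2 q.ne_zero
  have h : Kinv q * (K q * F q) * Kinv q = ((q : ℂ) ^ 2)⁻¹ • (Kinv q * F q) := by
    rw [K_mul_F, mul_smul_comm, smul_mul_assoc, mul_assoc, mul_assoc, K_mul_Kinv, mul_one]
  rw [← mul_assoc, Kinv_mul_K, one_mul] at h
  rw [h, smul_smul, mul_inv_cancel₀ hq, one_smul]

theorem E_mul_F : E q * F q = F q * E q +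
    (((q : ℂ) - (q : ℂ)⁻¹)⁻¹ • K q + (-((q : ℂ) - (q : ℂ)⁻¹)⁻¹) • Kinv q) := by
  have h : E q * F q - F q * E q = ((q : ℂ) - (q : ℂ)⁻¹)⁻¹ • (K q - Kinv q) := by
    simpa [gen] using mk_rel (URel.E_F (q := q))
  rw [sub_eq_iff_eq_add] at h
  rw [h, smul_sub, neg_smul, sub_eq_add_neg, add_comm]

theorem hom_ext {B : Type*} [Semiring B] [Algebra ℂ B] {f g : Uq q →ₐ[ℂ] B}
    (h : ∀ x, f (gen q x) = g (gen q x)) : f = g := by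
  apply RingQuot.ringQuot_ext'
  apply FreeAlgebra.hom_ext
  funext x
  exact h x

/-- The universal property of `U_q(sl₂)`. -/
def lift {B : Type*} [Ring B] [Algebra ℂ B] (f : UGen → B)
    (h₁ : f .K * f .Kinv = 1) (h₂ : f .Kinv * f .K = 1)
    (h₃ : f .K * f .E = (q : ℂ) ^ 2 • (f .E * f .K))
    (h₄ : f .K * f .F = ((q : ℂ) ^ 2)⁻¹ • (f .F * f .K))
    (h₅ : f .E * f .F - f .F * f .E = ((q : ℂ) - (q : ℂ)⁻¹)⁻¹ • (f .K - f .Kinv)) :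
    Uq q →ₐ[ℂ] B :=
  RingQuot.liftAlgHom ℂ ⟨FreeAlgebra.lift ℂ f, by
    intro x y h
    cases h <;>
      simp only [map_mul, map_smul, map_sub, map_one, FreeAlgebra.lift_ι_apply] <;> assumption⟩

@[simp]
theorem lift_gen {B : Type*} [Ring B] [Algebra ℂ B] (f : UGen → B) (h₁ h₂ h₃ h₄ h₅) (x : UGen) :
    lift (q := q) f h₁ h₂ h₃ h₄ h₅ (gen q x) = f x := by
  exact (RingQuot.liftAlgHom_mkAlgHom_apply ℂ (FreeAlgebra.lift ℂ f) _ (.ι ℂ x)).trans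
    (FreeAlgebra.lift_ι_apply f x)

/-- The values of the coproduct on the generators. -/
def comulGen (q : ℂˣ) : UGen → Uq q ⊗[ℂ] Uq q
  | .E => E q ⊗ₜ 1 + K q ⊗ₜ E q
  | .F => F q ⊗ₜ Kinv q + 1 ⊗ₜ F q
  | .K => K q ⊗ₜ K q
  | .Kinv => Kinv q ⊗ₜ Kinv q

/-- The values of the counit on the generators. -/
def counitGen : UGen → ℂ
  | .E => 0
  | .F => 0
  | .K => 1
  | .Kinv => 1

/-- The coproduct of `U_q(sl₂)`. -/
def comul (q : ℂˣ) : Uq q →ₐ[ℂ] Uq q ⊗[ℂ] Uq q := by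
  have hq : (q : ℂ) ≠ 0 := q.ne_zero
  refine lift (comulGen q) ?_ ?_ ?_ ?_ (sub_eq_iff_eq_add.2 ?_)
  · simp [comulGen, K_mul_Kinv, Algebra.TensorProduct.one_def]
  · simp [comulGen, Kinv_mul_K, Algebra.TensorProduct.one_def]
  · simp [comulGen, mul_add, add_mul, K_mul_E, TensorProduct.smul_tmul']
  · simp [comulGen, mul_add, add_mul, K_mul_F, K_mul_Kinv, Kinv_mul_K, TensorProduct.smul_tmul']
  · have h (x y : Uq q ⊗[ℂ] Uq q) : x - y = x + (-1 : ℂ) • y := by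
      rw [neg_one_smul, sub_eq_add_neg]
    simp only [comulGen, add_mul, mul_add, Algebra.TensorProduct.tmul_mul_tmul, one_mul, mul_one,
      K_mul_F, Kinv_mul_E, E_mul_F, TensorProduct.tmul_add, TensorProduct.add_tmul,
      TensorProduct.tmul_smul, ← TensorProduct.smul_tmul', smul_add, smul_smul, h]
    match_scalars <;> field_simp <;> ring

/-- The counit of `U_q(sl₂)`. -/
def counit (q : ℂˣ) : Uq q →ₐ[ℂ] ℂ := by
  refine lift counitGen ?_ ?_ ?_ ?_ ?_ <;> simp [counitGen]

@[simp]
theorem comul_gen (x : UGen) : comul q (gen q x) = comulGen q x := by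
  simp [comul]

@[simp]
theorem counit_gen (x : UGen) : counit q (gen q x) = counitGen x := by
  simp [counit]

instance : Bialgebra ℂ (Uq q) :=
  Bialgebra.ofAlgHom (comul q) (counit q)
    (by
      apply hom_ext
      rintro (_ | _ | _ | _) <;>
        simp [comulGen, TensorProduct.tmul_add, TensorProduct.add_tmul,
          Algebra.TensorProduct.one_def, add_assoc])
    (by apply hom_ext; rintro (_ | _ | _ | _) <;> simp [comulGen, counitGen])
    (by apply hom_ext; rintro (_ | _ | _ | _) <;> simp [comulGen, counitGen])

end Uq

/-! ### The irreducible modules of type `1` -/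

/-- The quantum integer `[n] = (q ^ n - q ^ (-n)) / (q - q⁻¹)`. -/
def qInt (q : ℂˣ) (n : ℤ) : ℂ := ((q : ℂ) ^ n - (q : ℂ) ^ (-n)) / ((q : ℂ) - (q : ℂ)⁻¹)

/-- The vector space underlying the irreducible type `1` module of highest weight `m`. Its standard
basis `v₀, …, v_m` consists of weight vectors, and `v₀` is a highest weight vector. -/
abbrev V (m : ℕ) : Type := Fin (m + 1) → ℂ

namespace V

variable {q : ℂˣ} {m : ℕ}

/-- `E v_j = [m - j + 1] v_{j-1}`, with `E v₀ = 0`. -/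
def opE (q : ℂˣ) (m : ℕ) : Module.End ℂ (V m) where
  toFun f i := if h : (i : ℕ) < m then qInt q (m - i) * f ⟨i + 1, by omega⟩ else 0
  map_add' f g := by ext i; simp only [Pi.add_apply]; split_ifs <;> ring
  map_smul' c f := by
    ext i; simp only [Pi.smul_apply, smul_eq_mul, RingHom.id_apply]; split_ifs <;> ring

/-- `F v_j = [j + 1] v_{j+1}`, with `F v_m = 0`. -/
def opF (q : ℂˣ) (m : ℕ) : Module.End ℂ (V m) where
  toFun f i := if 0 < (i : ℕ) then qInt q i * f ⟨i - 1, by omega⟩ else 0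
  map_add' f g := by ext i; simp only [Pi.add_apply]; split_ifs <;> ring
  map_smul' c f := by
    ext i; simp only [Pi.smul_apply, smul_eq_mul, RingHom.id_apply]; split_ifs <;> ring

/-- `K v_j = q ^ (m - 2 j) v_j`. -/
def opK (q : ℂˣ) (m : ℕ) : Module.End ℂ (V m) where
  toFun f i := (q : ℂ) ^ ((m : ℤ) - 2 * i) * f i
  map_add' f g := by ext i; simp only [Pi.add_apply]; ring
  map_smul' c f := by ext i; simp only [Pi.smul_apply, smul_eq_mul, RingHom.id_apply]; ring

/-- `K⁻¹ v_j = q ^ (-(m - 2 j)) v_j`. -/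
def opKinv (q : ℂˣ) (m : ℕ) : Module.End ℂ (V m) where
  toFun f i := (q : ℂ) ^ (-((m : ℤ) - 2 * i)) * f i
  map_add' f g := by ext i; simp only [Pi.add_apply]; ring
  map_smul' c f := by ext i; simp only [Pi.smul_apply, smul_eq_mul, RingHom.id_apply]; ring

/-- The action of the generators of `U_q(sl₂)`. -/
def opGen (q : ℂˣ) (m : ℕ) : UGen → Module.End ℂ (V m)
  | .E => opE q m
  | .F => opF q m
  | .K => opK q m
  | .Kinv => opKinv q m

theorem opE_apply (f : V m) (i : Fin (m + 1)) :
    opE q m f i = if h : (i : ℕ) < m then qInt q (m - i) * f ⟨i + 1, by omega⟩ else 0 := rfl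

theorem opF_apply (f : V m) (i : Fin (m + 1)) :
    opF q m f i = if 0 < (i : ℕ) then qInt q i * f ⟨i - 1, by omega⟩ else 0 := rfl

theorem opK_apply (f : V m) (i : Fin (m + 1)) :
    opK q m f i = (q : ℂ) ^ ((m : ℤ) - 2 * i) * f i := rfl

theorem opKinv_apply (f : V m) (i : Fin (m + 1)) :
    opKinv q m f i = (q : ℂ) ^ (-((m : ℤ) - 2 * i)) * f i := rfl

theorem qInt_identity (i n : ℤ) :
    qInt q (n - i) * qInt q (i + 1) - qInt q i * qInt q (n - i + 1) =
      ((q : ℂ) - (q : ℂ)⁻¹)⁻¹ * ((q : ℂ) ^ (n - 2 * i) - (q : ℂ) ^ (-(n - 2 * i))) := by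
  have hq : (q : ℂ) ≠ 0 := q.ne_zero
  have h : ((q : ℂ) ^ (n - i) - (q : ℂ) ^ (-(n - i))) * ((q : ℂ) ^ (i + 1) - (q : ℂ) ^ (-(i + 1))) -
      ((q : ℂ) ^ i - (q : ℂ) ^ (-i)) * ((q : ℂ) ^ (n - i + 1) - (q : ℂ) ^ (-(n - i + 1))) =
      ((q : ℂ) - (q : ℂ)⁻¹) * ((q : ℂ) ^ (n - 2 * i) - (q : ℂ) ^ (-(n - 2 * i))) := by
    rw [← zpow_neg_one (q : ℂ)]
    nth_rewrite 9 [← zpow_one (q : ℂ)]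
    simp only [sub_mul, mul_sub, ← zpow_add₀ hq]
    ring_nf
  by_cases h0 : (q : ℂ) - (q : ℂ)⁻¹ = 0
  · simp [qInt, h0]
  · have h1 := inv_mul_cancel₀ h0
    simp only [qInt, div_eq_mul_inv]
    generalize ((q : ℂ) - (q : ℂ)⁻¹)⁻¹ = s at h1 ⊢
    linear_combination s * s * h +
      s * ((q : ℂ) ^ (n - 2 * i) - (q : ℂ) ^ (-(n - 2 * i))) * h1

/-- The action of `U_q(sl₂)` on its irreducible type `1` module of highest weight `m`. -/
def rep (q : ℂˣ) (m : ℕ) : Uq q →ₐ[ℂ] Module.End ℂ (V m) := by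
  have hq : (q : ℂ) ≠ 0 := q.ne_zero
  refine Uq.lift (opGen q m) ?_ ?_ ?_ ?_ ?_ <;>
    refine LinearMap.ext fun f => funext fun i => ?_
  · simp only [opGen, Module.End.mul_apply, opK_apply, opKinv_apply, Module.End.one_apply]
    rw [← mul_assoc, ← zpow_add₀ hq, add_neg_cancel, zpow_zero, one_mul]
  · simp only [opGen, Module.End.mul_apply, opK_apply, opKinv_apply, Module.End.one_apply]
    rw [← mul_assoc, ← zpow_add₀ hq, neg_add_cancel, zpow_zero, one_mul]
  · simp only [opGen, Module.End.mul_apply, opK_apply, opE_apply, LinearMap.smul_apply,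
      Pi.smul_apply, smul_eq_mul]
    split_ifs with h
    · have e : (q : ℂ) ^ ((m : ℤ) - 2 * (i : ℕ)) =
          (q : ℂ) ^ 2 * (q : ℂ) ^ ((m : ℤ) - 2 * ((i : ℕ) + 1 : ℕ)) := by
        rw [← zpow_natCast, ← zpow_add₀ hq]; congr 1; push_cast; ring
      rw [e]; ring
    · simp
  · simp only [opGen, Module.End.mul_apply, opK_apply, opF_apply, LinearMap.smul_apply,
      Pi.smul_apply, smul_eq_mul]
    split_ifs with h
    · have e : (q : ℂ) ^ ((m : ℤ) - 2 * (i : ℕ)) =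
          ((q : ℂ) ^ 2)⁻¹ * (q : ℂ) ^ ((m : ℤ) - 2 * ((i : ℕ) - 1 : ℕ)) := by
        rw [← zpow_natCast, ← zpow_neg, ← zpow_add₀ hq]
        congr 1
        rw [Nat.cast_sub h]; push_cast; ring
      rw [e]; ring
    · simp
  · simp only [opGen, Module.End.mul_apply, opK_apply, opKinv_apply, opE_apply, opF_apply,
      LinearMap.smul_apply, LinearMap.sub_apply, Pi.sub_apply, Pi.smul_apply, smul_eq_mul]
    have key := qInt_identity (q := q) (i : ℕ) m
    have z0 : qInt q 0 = 0 := by simp [qInt]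
    rw [← sub_mul, ← mul_assoc, ← key]
    obtain ⟨i, hi⟩ := i
    rcases Nat.eq_zero_or_pos i with rfl | hpos
    · rcases Nat.eq_zero_or_pos m with rfl | hm
      · simp [z0]
      · simp [hm, z0, mul_assoc]
    · have e1 : i - 1 + 1 = i := by omega
      have e2 : i - 1 < m := by omega
      have e3 : (m : ℤ) - ((i - 1 : ℕ) : ℤ) = m - i + 1 := by omega
      by_cases h : i < m
      · simp only [hpos, h, e1, e2, e3, Nat.add_sub_cancel, Nat.zero_lt_succ, if_true, dif_pos,
          Nat.cast_add, Nat.cast_one]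
        ring
      · obtain rfl : m = i := by omega
        simp only [hpos, e1, e2, e3, if_true, dif_pos, lt_irrefl, dif_neg, not_false_iff, sub_self,
          z0]
        ring

@[simp]
theorem rep_gen (x : UGen) : rep q m (Uq.gen q x) = opGen q m x := by
  simp [rep]

end V

/-! ### Matrix coefficients and the Peter–Weyl filtration -/

/-- The matrix coefficient `u ↦ φ (u v)` of the irreducible module `V m`. -/
def matrixCoeff (q : ℂˣ) (m : ℕ) (φ : Module.Dual ℂ (V m)) (v : V m) : Module.Dual ℂ (Uq q) :=
  φ ∘ₗ LinearMap.applyₗ v ∘ₗ (V.rep q m).toLinearMap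

@[simp]
theorem matrixCoeff_apply (q : ℂˣ) (m : ℕ) (φ : Module.Dual ℂ (V m)) (v : V m) (u : Uq q) :
    matrixCoeff q m φ v u = φ (V.rep q m u v) := rfl

/-- The matrix coefficients of the standard representation `V 1` with respect to its standard
basis. -/
def stdCoeff (q : ℂˣ) (i j : Fin 2) : WithConv (Uq q →ₗ[ℂ] ℂ) :=
  .toConv (matrixCoeff q 1 (LinearMap.proj i) (Pi.single j 1))

/-- The generators `a, b, c, d` correspond to the four entries of the standard representation. -/
def pairingGen (q : ℂˣ) : MatGen → WithConv (Uq q →ₗ[ℂ] ℂ)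
  | .a => stdCoeff q 0 0
  | .b => stdCoeff q 0 1
  | .c => stdCoeff q 1 0
  | .d => stdCoeff q 1 1

namespace Pairing

variable {q : ℂˣ}

/-- The action of `U_q(sl₂)` on the tensor square of the standard representation. -/
def tensorRep (q : ℂˣ) : Uq q →ₐ[ℂ] Module.End ℂ (V 1 ⊗[ℂ] V 1) :=
  Module.endTensorEndAlgHom.comp
    ((Algebra.TensorProduct.map (V.rep q 1) (V.rep q 1)).comp (Uq.comul q))

/-- The tensor product of two functionals. -/
def tensorFun (φ ψ : Module.Dual ℂ (V 1)) : V 1 ⊗[ℂ] V 1 →ₗ[ℂ] ℂ :=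
  LinearMap.mul' ℂ ℂ ∘ₗ TensorProduct.map φ ψ

theorem stdCoeff_mul (i j k l : Fin 2) (u : Uq q) :
    (stdCoeff q i j * stdCoeff q k l) u = tensorFun (LinearMap.proj i) (LinearMap.proj k)
      (tensorRep q u ((Pi.single j 1 : V 1) ⊗ₜ (Pi.single l 1 : V 1))) := by
  have h (t : Uq q ⊗[ℂ] Uq q) :
      LinearMap.mul' ℂ ℂ (TensorProduct.map (stdCoeff q i j).ofConv (stdCoeff q k l).ofConv t) =
      tensorFun (LinearMap.proj i) (LinearMap.proj k) (Module.endTensorEndAlgHom (R := ℂ) (S := ℂ)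
        (A := ℂ) (Algebra.TensorProduct.map (V.rep q 1) (V.rep q 1) t)
        ((Pi.single j 1 : V 1) ⊗ₜ (Pi.single l 1 : V 1))) := by
    induction t with
    | zero => simp
    | tmul x y =>
      rw [Algebra.TensorProduct.map_tmul, Module.endTensorEndAlgHom_apply]
      simp [tensorFun, stdCoeff]
    | add x y hx hy => simp only [map_add, LinearMap.add_apply, hx, hy]
  exact h (Uq.comul q u)

theorem tensorRep_invariant (w : V 1 ⊗[ℂ] V 1)
    (hw : ∀ x, tensorRep q (Uq.gen q x) w = Uq.counitGen x • w) (u : Uq q) :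
    tensorRep q u w = Uq.counit q u • w := by
  obtain ⟨u, rfl⟩ := Uq.mk_surjective u
  induction u using FreeAlgebra.induction with
  | grade0 r => simp [AlgHom.commutes, Module.algebraMap_end_apply]
  | grade1 x => simpa [Uq.gen] using (hw x).trans (by rw [← Uq.counit_gen (q := q) x]; rfl)
  | mul x y hx hy => simp [hx, hy, smul_smul, mul_comm]
  | add x y hx hy => simp [hx, hy, add_smul]

theorem tensorRep_coinvariant (w : V 1 ⊗[ℂ] V 1 →ₗ[ℂ] ℂ)
    (hw : ∀ x, w ∘ₗ tensorRep q (Uq.gen q x) = Uq.counitGen x • w) (u : Uq q) :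
    w ∘ₗ tensorRep q u = Uq.counit q u • w := by
  obtain ⟨u, rfl⟩ := Uq.mk_surjective u
  induction u using FreeAlgebra.induction with
  | grade0 r => ext; simp [AlgHom.commutes, Module.algebraMap_end_apply]
  | grade1 x => exact (hw x).trans (by rw [← Uq.counit_gen (q := q) x]; rfl)
  | mul x y hx hy =>
    rw [map_mul, map_mul, map_mul, Module.End.mul_eq_comp, ← LinearMap.comp_assoc, hx,
      LinearMap.smul_comp, hy, smul_smul]
  | add x y hx hy => rw [map_add, map_add, map_add, LinearMap.comp_add, hx, hy, add_smul]

/-- The standard basis of `V 1`. -/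
abbrev e (i : Fin 2) : V 1 := Pi.single i 1

theorem opE_e0 : V.opE q 1 (e 0) = 0 := by
  ext i; fin_cases i <;> simp [V.opE_apply]

theorem opE_e1 : V.opE q 1 (e 1) = qInt q 1 • e 0 := by
  ext i; fin_cases i <;> simp [V.opE_apply]

theorem opF_e0 : V.opF q 1 (e 0) = qInt q 1 • e 1 := by
  ext i; fin_cases i <;> simp [V.opF_apply]

theorem opF_e1 : V.opF q 1 (e 1) = 0 := by
  ext i; fin_cases i <;> simp [V.opF_apply]

theorem opK_e0 : V.opK q 1 (e 0) = (q : ℂ) • e 0 := by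
  ext i; fin_cases i <;> simp [V.opK_apply]

theorem opK_e1 : V.opK q 1 (e 1) = (q : ℂ)⁻¹ • e 1 := by
  ext i; fin_cases i <;> norm_num [V.opK_apply]

theorem opKinv_e0 : V.opKinv q 1 (e 0) = (q : ℂ)⁻¹ • e 0 := by
  ext i; fin_cases i <;> norm_num [V.opKinv_apply]

theorem opKinv_e1 : V.opKinv q 1 (e 1) = (q : ℂ) • e 1 := by
  ext i; fin_cases i <;> simp [V.opKinv_apply]

theorem endTensor_tmul (f g : Module.End ℂ (V 1)) (v w : V 1) :
    Module.endTensorEndAlgHom (R := ℂ) (S := ℂ) (A := ℂ) (f ⊗ₜ[ℂ] g) (v ⊗ₜ[ℂ] w) =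
      f v ⊗ₜ[ℂ] g w := by
  rw [Module.endTensorEndAlgHom_apply]; rfl

/-- The action of the generators on pure tensors. -/
theorem tensorRep_E (v w : V 1) : tensorRep q (Uq.gen q .E) (v ⊗ₜ w) =
    V.opE q 1 v ⊗ₜ w + V.opK q 1 v ⊗ₜ V.opE q 1 w := by
  simp [tensorRep, Uq.comulGen, V.opGen, endTensor_tmul]

theorem tensorRep_F (v w : V 1) : tensorRep q (Uq.gen q .F) (v ⊗ₜ w) =
    V.opF q 1 v ⊗ₜ V.opKinv q 1 w + v ⊗ₜ V.opF q 1 w := by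
  simp [tensorRep, Uq.comulGen, V.opGen, endTensor_tmul]

theorem tensorRep_K (v w : V 1) : tensorRep q (Uq.gen q .K) (v ⊗ₜ w) =
    V.opK q 1 v ⊗ₜ V.opK q 1 w := by
  simp [tensorRep, Uq.comulGen, V.opGen, endTensor_tmul]

theorem tensorRep_Kinv (v w : V 1) : tensorRep q (Uq.gen q .Kinv) (v ⊗ₜ w) =
    V.opKinv q 1 v ⊗ₜ V.opKinv q 1 w := by
  simp [tensorRep, Uq.comulGen, V.opGen, endTensor_tmul]

theorem invariant (u : Uq q) :
    tensorRep q u (e 0 ⊗ₜ e 1 - (q : ℂ) • (e 1 ⊗ₜ e 0)) =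
      Uq.counit q u • (e 0 ⊗ₜ e 1 - (q : ℂ) • (e 1 ⊗ₜ e 0)) := by
  have hq : (q : ℂ) ≠ 0 := q.ne_zero
  apply tensorRep_invariant
  rintro (_ | _ | _ | _) <;>
    simp only [map_sub, map_smul, tensorRep_E, tensorRep_F, tensorRep_K, tensorRep_Kinv, opE_e0,
      opE_e1, opF_e0, opF_e1, opK_e0, opK_e1, opKinv_e0, opKinv_e1, Uq.counitGen,
      TensorProduct.zero_tmul, TensorProduct.tmul_zero, TensorProduct.tmul_smul,
      ← TensorProduct.smul_tmul', smul_smul, zero_smul, zero_add, add_zero, one_smul,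
      mul_inv_cancel₀ hq, inv_mul_cancel₀ hq] <;>
    module

theorem tensor_ext {f g : V 1 ⊗[ℂ] V 1 →ₗ[ℂ] ℂ}
    (h : ∀ i j, f (e i ⊗ₜ e j) = g (e i ⊗ₜ e j)) : f = g := by
  apply TensorProduct.ext
  apply LinearMap.pi_ext'
  intro i
  ext
  exact h _ _

theorem tensorFun_e (i j k l : Fin 2) :
    tensorFun (LinearMap.proj i) (LinearMap.proj k) (e j ⊗ₜ e l) =
      (if i = j then 1 else 0) * (if k = l then 1 else 0) := by
  simp [tensorFun, Pi.single_apply]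

/-- The invariant functional on the tensor square of the standard representation. -/
def coinv (q : ℂˣ) : V 1 ⊗[ℂ] V 1 →ₗ[ℂ] ℂ :=
  tensorFun (LinearMap.proj 0) (LinearMap.proj 1) -
    (q : ℂ) • tensorFun (LinearMap.proj 1) (LinearMap.proj 0)

theorem coinv_e (j l : Fin 2) : coinv q (e j ⊗ₜ e l) =
    (if 0 = j then 1 else 0) * (if 1 = l then 1 else 0) -
      (q : ℂ) * ((if 1 = j then 1 else 0) * (if 0 = l then 1 else 0)) := by
  rw [coinv, LinearMap.sub_apply, LinearMap.smul_apply, tensorFun_e, tensorFun_e, smul_eq_mul]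

theorem coinvariant (u : Uq q) : coinv q ∘ₗ tensorRep q u = Uq.counit q u • coinv q := by
  have hq : (q : ℂ) ≠ 0 := q.ne_zero
  apply tensorRep_coinvariant
  intro x
  apply tensor_ext
  intro i j
  cases x <;> fin_cases i <;> fin_cases j <;>
    simp [tensorRep_E, tensorRep_F, tensorRep_K, tensorRep_Kinv, opE_e0, opE_e1, opF_e0, opF_e1,
      opK_e0, opK_e1, opKinv_e0, opKinv_e1, Uq.counitGen, coinv, tensorFun_e,
      TensorProduct.tmul_smul, ← TensorProduct.smul_tmul', hq] <;>
    field_simp <;> simp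

/-- The relations coming from the invariant vector. -/
theorem row_rel (i k : Fin 2) (u : Uq q) :
    (stdCoeff q i 0 * stdCoeff q k 1) u - (q : ℂ) * (stdCoeff q i 1 * stdCoeff q k 0) u =
      Uq.counit q u * (tensorFun (LinearMap.proj i) (LinearMap.proj k)
        (e 0 ⊗ₜ e 1 - (q : ℂ) • (e 1 ⊗ₜ e 0))) := by
  rw [stdCoeff_mul, stdCoeff_mul, ← smul_eq_mul, ← smul_eq_mul, ← map_smul, ← map_smul, ← map_sub,
    ← map_smul, ← map_sub, invariant, map_smul]

/-- The relations coming from the invariant functional. -/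
theorem col_rel (j l : Fin 2) (u : Uq q) :
    (stdCoeff q 0 j * stdCoeff q 1 l) u - (q : ℂ) * (stdCoeff q 1 j * stdCoeff q 0 l) u =
      Uq.counit q u * coinv q (e j ⊗ₜ e l) := by
  rw [stdCoeff_mul, stdCoeff_mul]
  exact LinearMap.congr_fun (coinvariant u) (e j ⊗ₜ e l)

end Pairing

theorem entry_relations (q : ℂˣ) (u : Uq q) :
    (stdCoeff q 0 0 * stdCoeff q 0 1) u = (q : ℂ) * (stdCoeff q 0 1 * stdCoeff q 0 0) u ∧
    (stdCoeff q 0 0 * stdCoeff q 1 0) u = (q : ℂ) * (stdCoeff q 1 0 * stdCoeff q 0 0) u ∧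
    (stdCoeff q 0 1 * stdCoeff q 1 0) u = (stdCoeff q 1 0 * stdCoeff q 0 1) u ∧
    (stdCoeff q 0 1 * stdCoeff q 1 1) u = (q : ℂ) * (stdCoeff q 1 1 * stdCoeff q 0 1) u ∧
    (stdCoeff q 1 0 * stdCoeff q 1 1) u = (q : ℂ) * (stdCoeff q 1 1 * stdCoeff q 1 0) u ∧
    (stdCoeff q 0 0 * stdCoeff q 1 1) u - (stdCoeff q 1 1 * stdCoeff q 0 0) u =
      ((q : ℂ) - (q : ℂ)⁻¹) * (stdCoeff q 0 1 * stdCoeff q 1 0) u ∧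
    (stdCoeff q 0 0 * stdCoeff q 1 1) u - (q : ℂ) * (stdCoeff q 0 1 * stdCoeff q 1 0) u =
      Uq.counit q u := by
  have hq : (q : ℂ) ≠ 0 := q.ne_zero
  have r00 := Pairing.row_rel (q := q) 0 0 u
  have r01 := Pairing.row_rel (q := q) 0 1 u
  have r11 := Pairing.row_rel (q := q) 1 1 u
  have c00 := Pairing.col_rel (q := q) 0 0 u
  have c10 := Pairing.col_rel (q := q) 1 0 u
  have c01 := Pairing.col_rel (q := q) 0 1 u
  have c11 := Pairing.col_rel (q := q) 1 1 u
  simp only [map_sub, map_smul, Pairing.coinv_e, Pairing.tensorFun_e, smul_eq_mul, if_pos,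
    if_neg zero_ne_one, if_neg one_ne_zero, mul_zero, mul_one, sub_zero, zero_sub, mul_neg]
    at r00 r01 r11 c00 c10 c01 c11
  have bc : (stdCoeff q 0 1 * stdCoeff q 1 0) u = (stdCoeff q 1 0 * stdCoeff q 0 1) u := by
    apply mul_left_cancel₀ hq
    linear_combination c01 - r01
  refine ⟨by linear_combination r00, by linear_combination c00, bc, by linear_combination c11,
    by linear_combination r11, ?_, r01⟩
  field_simp
  linear_combination (q : ℂ) * r01 + c10

/-- The algebra homomorphism from `O_q(Mat₂)` to the dual of `U_q(sl₂)`, with the convolution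
product, that sends the generators to the matrix coefficients of the standard representation. -/
def matPairing (q : ℂˣ) : OqMat2 q →ₐ[ℂ] WithConv (Uq q →ₗ[ℂ] ℂ) :=
  OqMat2.lift (pairingGen q)
    (by ext u; exact (entry_relations q u).1)
    (by ext u; exact (entry_relations q u).2.1)
    (by ext u; exact (entry_relations q u).2.2.1)
    (by ext u; exact (entry_relations q u).2.2.2.1)
    (by ext u; exact (entry_relations q u).2.2.2.2.1)
    (by ext u; exact (entry_relations q u).2.2.2.2.2.1)

theorem matPairing_qdet (q : ℂˣ) : matPairing q (OqMat2.qdet q) = 1 := by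
  simp only [OqMat2.qdet, map_sub, map_mul, map_smul, matPairing, OqMat2.lift_gen]
  ext u
  exact (entry_relations q u).2.2.2.2.2.2

/-- The identification of `O_q(SL₂)` with an algebra of matrix coefficients: the algebra
homomorphism from `O_q(SL₂)` to the dual of `U_q(sl₂)`, with the convolution product, that sends the
generators `a, b, c, d` to the matrix coefficients of the standard representation `V 1`. -/
def pairing (q : ℂˣ) : OqSL2 q →ₐ[ℂ] WithConv (Uq q →ₗ[ℂ] ℂ) :=
  OqSL2.lift (matPairing q) (matPairing_qdet q)

/-- The span of the matrix coefficients of `V m`: the image of `V m ⊗ (V m)^*` in the dual of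
`U_q(sl₂)`. -/
def coeffSpace (q : ℂˣ) (m : ℕ) : Submodule ℂ (Module.Dual ℂ (Uq q)) :=
  Submodule.span ℂ {f | ∃ (φ : Module.Dual ℂ (V m)) (v : V m), f = matrixCoeff q m φ v}

/-- The dominance ordering on weights of `sl₂`: the difference is a nonnegative multiple of the
simple root, which is `2` when the fundamental weight is `1`. -/
def DominanceLE (m n : ℤ) : Prop := ∃ k : ℕ, n - m = 2 * k

/-- The Peter–Weyl filtration on `O_q(SL₂)`: the elements corresponding to sums of matrix
coefficients of the modules `V m` with `m ≤ n` in the dominance ordering. -/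
def peterWeyl (q : ℂˣ) (n : ℤ) : Submodule ℂ (OqSL2 q) :=
  (⨆ (m : ℕ) (_ : DominanceLE m n), coeffSpace q m).comap
    ((WithConv.linearEquiv ℂ (Uq q →ₗ[ℂ] ℂ)).toLinearMap ∘ₗ (pairing q).toLinearMap)

/-- The algebra `O_q(SL₂)[z]` of polynomials in a central variable `z`, with its bialgebra structure
in which `z` is grouplike. The element `f z ^ n` is `AddMonoidAlgebra.single n f`. -/
abbrev OqSL2z (q : ℂˣ) : Type := AddMonoidAlgebra (OqSL2 q) ℕ

/-- The graded subspace `⨁ₙ O_q(SL₂)_{≤ n} z ^ n` of `O_q(SL₂)[z]`. -/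
def rees (q : ℂˣ) : Submodule ℂ (OqSL2z q) where
  carrier := {p | ∀ n : ℕ, p.coeff n ∈ peterWeyl q n}
  zero_mem' n := by simp
  add_mem' hp hp' n := by simpa using add_mem (hp n) (hp' n)
  smul_mem' c p hp n := by simpa using (peterWeyl q n).smul_mem c (hp n)

/-! ### Sub-bialgebras -/

/-- A sub-bialgebra of a complex bialgebra `B`: a subalgebra with a coalgebra structure which is the
restriction of that of `B`. Both structure maps are determined by the subalgebra, since the map
`S ⊗ S → B ⊗ B` is injective. -/
structure SubBialgebra (B : Type*) [Ring B] [Bialgebra ℂ B] extends Subalgebra ℂ B where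
  coalgebra : Coalgebra ℂ toSubalgebra
  map_comul (x : toSubalgebra) :
    TensorProduct.map toSubalgebra.val.toLinearMap toSubalgebra.val.toLinearMap
      (coalgebra.comul x) = Coalgebra.comul (R := ℂ) (x : B)
  counit_coe (x : toSubalgebra) : coalgebra.counit x = Coalgebra.counit (R := ℂ) (x : B)

namespace SubBialgebra

variable {B : Type*} [Ring B] [Bialgebra ℂ B] (S : SubBialgebra B)

theorem comul_ext {s t : S.toSubalgebra ⊗[ℂ] S.toSubalgebra}
    (h : Algebra.TensorProduct.map S.toSubalgebra.val S.toSubalgebra.val s =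
      Algebra.TensorProduct.map S.toSubalgebra.val S.toSubalgebra.val t) : s = t :=
  TensorProduct.map_injective_of_flat_flat S.toSubalgebra.val.toLinearMap
    S.toSubalgebra.val.toLinearMap Subtype.val_injective Subtype.val_injective h

theorem map_comul' (x : S.toSubalgebra) :
    Algebra.TensorProduct.map S.toSubalgebra.val S.toSubalgebra.val (S.coalgebra.comul x) =
      Coalgebra.comul (R := ℂ) (x : B) := S.map_comul x

instance : Coalgebra ℂ S.toSubalgebra := S.coalgebra

instance : Bialgebra ℂ S.toSubalgebra :=
  Bialgebra.mk' ℂ S.toSubalgebra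
    (by rw [S.counit_coe]; simp)
    (by intro a b; rw [S.counit_coe, S.counit_coe, S.counit_coe]; simp)
    (by apply S.comul_ext; rw [S.map_comul']; simp)
    (by
      intro a b
      apply S.comul_ext
      rw [map_mul (Algebra.TensorProduct.map S.toSubalgebra.val S.toSubalgebra.val),
        S.map_comul', S.map_comul', S.map_comul']
      simp)

end SubBialgebra

end QuantumSL2
end

noncomputable section

namespace QuantumSL2

/-! The isomorphism comes from the algebra map `toOqSL2z` out of `O_q(Mat₂)` that multiplies each
generator by `z`. The relations are homogeneous, so the map exists. It respects coproduct and counit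
because `z` is grouplike, it sends an element `x` of degree `n` to `x̄ zⁿ`, where `x̄` is the class
of `x` in `O_q(SL₂)`, and it sends `D_q` to `z²`. What remains is that it is injective with image
the Rees subspace. The image then inherits a coalgebra structure by transport.

Both facts follow from one statement: in each degree `n`, the pairing with `U_q(sl₂)` maps the span
of ordered monomials isomorphically onto the span of the matrix coefficients of the `V m` with `m ≤
n` and `m ≡ n` mod 2. This is a dimension count. Above, there are `(n + 3).choose 3` ordered
monomials. Below, the coefficients in standard bases are linearly independent
(`linearIndependent_basisCoeff`), and the squares `(m + 1)²` add up to the same binomial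
(`sum_sq_eq_choose`). The coefficients are all reached: `V (m + 1)` embeds in `V 1 ⊗ V m`, so
coefficients of `V m` come from degree `m` (`coeffSpace_le_map_matPairingₗ`), and multiplication by
`D_q`, which pairs as the unit, raises the degree by two. No prior knowledge that ordered monomials
are independent is needed.

Linear independence uses that `q` is not a root of unity: the Casimir element separates the modules,
`K` separates the weights, and `E`, `F` move between weights, so `U_q(sl₂)` produces every matrix
unit of one module while killing finitely many others.

In `O_q(SL₂)` every element is a sum of images of two consecutive degrees. Their functionals lie in
coefficient spaces of opposite parity, which are disjoint, so the pairing is injective there and the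
Peter–Weyl filtration is the filtration by degree (`peterWeyl_eq_map`). -/

theorem aeval_apply_of_diagonal {ι : Type*} {T : Module.End ℂ (ι → ℂ)} {μ : ι → ℂ}
    (hT : ∀ f i, T f i = μ i * f i) (p : Polynomial ℂ) (f : ι → ℂ) (i : ι) :
    Polynomial.aeval T p f i = p.eval (μ i) * f i := by
  induction p using Polynomial.induction_on' with
  | add p r hp hr => simp [hp, hr, add_mul]
  | monomial n c =>
    have h : ∀ f, (T ^ n) f i = μ i ^ n * f i := by
      induction n with
      | zero => simp
      | succ n ih => intro f; rw [pow_succ, Module.End.mul_apply, ih, hT]; ring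
    rw [Polynomial.aeval_monomial, Module.End.mul_apply, Module.algebraMap_end_apply, Pi.smul_apply,
      h, smul_eq_mul, Polynomial.eval_monomial, mul_assoc]

/-! ### Quantum integers and matrix units of the modules `V m` -/

variable {q : ℂˣ}
theorem zpow_ne_one (hq : ∀ n : ℕ, 0 < n → q ^ n ≠ 1) {n : ℤ} (hn : n ≠ 0) : (q : ℂ) ^ n ≠ 1 := by
  have h : ∀ k : ℕ, 0 < k → (q : ℂ) ^ k ≠ 1 := fun k hk h => hq k hk (by ext; simpa using h)
  obtain ⟨k, rfl | rfl⟩ := n.eq_nat_or_neg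
  · rw [zpow_natCast]; exact h k (by omega)
  · rw [zpow_neg, zpow_natCast, ne_eq, inv_eq_one]; exact h k (by omega)

theorem zpow_injective (hq : ∀ n : ℕ, 0 < n → q ^ n ≠ 1) :
    Function.Injective fun n : ℤ => (q : ℂ) ^ n := by
  intro m n h
  by_contra hmn
  apply zpow_ne_one hq (sub_ne_zero.2 hmn)
  rw [zpow_sub₀ q.ne_zero, show (q : ℂ) ^ m = (q : ℂ) ^ n from h,
    div_self (zpow_ne_zero _ q.ne_zero)]

theorem sub_inv_ne_zero (hq : ∀ n : ℕ, 0 < n → q ^ n ≠ 1) : (q : ℂ) - (q : ℂ)⁻¹ ≠ 0 := by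
  rw [sub_ne_zero, ← zpow_neg_one]
  nth_rewrite 1 [← zpow_one (q : ℂ)]
  exact (zpow_injective hq).ne (by decide)

theorem qInt_ne_zero (hq : ∀ n : ℕ, 0 < n → q ^ n ≠ 1) {n : ℤ} (hn : n ≠ 0) : qInt q n ≠ 0 :=
  div_ne_zero (sub_ne_zero.2 ((zpow_injective hq).ne (by omega))) (sub_inv_ne_zero hq)

namespace V

variable {m : ℕ}

/-- Each application of `E` shifts coordinates by one, so the highest weight coordinate of `E ^ j f`
sees only `f j`. With `opF_pow_single_zero` this gives the passage from any weight to any other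
through the highest one. -/
theorem opE_pow_apply_zero (j : Fin (m + 1)) (f : V m) :
    (opE q m ^ (j : ℕ)) f 0 = (∏ k ∈ Finset.range j, qInt q (m - k)) * f j := by
  obtain ⟨j, hj⟩ := j
  induction j generalizing f with
  | zero => simp
  | succ j ih =>
    rw [pow_succ, Module.End.mul_apply]
    have := ih (opE q m f) (by omega)
    dsimp only at this ⊢
    rw [this, opE_apply, Finset.prod_range_succ, dif_pos (by simpa using hj), mul_assoc]

theorem opF_single (i : ℕ) (hi : i + 1 < m + 1) :
    opF q m (Pi.single ⟨i, by omega⟩ 1) = qInt q (i + 1) • Pi.single ⟨i + 1, hi⟩ 1 := by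
  ext ⟨k, hk⟩
  simp only [opF_apply, Pi.smul_apply, Pi.single_apply, smul_eq_mul, Fin.mk.injEq]
  rcases k with _ | k
  · simp
  · by_cases h : k = i <;> simp [h]

theorem opF_pow_single_zero (i : Fin (m + 1)) :
    (opF q m ^ (i : ℕ)) (Pi.single 0 1) =
      (∏ k ∈ Finset.range i, qInt q (k + 1)) • Pi.single i 1 := by
  obtain ⟨i, hi⟩ := i
  induction i with
  | zero => simp
  | succ i ih =>
    have := ih (by omega)
    dsimp only at this ⊢
    rw [pow_succ', Module.End.mul_apply, this, map_smul, opF_single, smul_smul,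
      Finset.prod_range_succ]

/-- The eigenvalue of the Casimir element on `V m`. -/
def casimirValue (q : ℂˣ) (m : ℕ) : ℂ :=
  ((q : ℂ) ^ ((m : ℤ) + 1) + (q : ℂ) ^ (-((m : ℤ) + 1))) / ((q : ℂ) - (q : ℂ)⁻¹) ^ 2

/-- With `x = q ^ (m + 1)` and `y = q ^ (n + 1)`, the equation `x + x⁻¹ = y + y⁻¹` amounts to `(x -
y) (x y - 1) = 0`. For `m ≠ n` neither factor vanishes, since `x / y` and `x y` are nontrivial
powers of `q`. -/
theorem casimirValue_injective (hq : ∀ n : ℕ, 0 < n → q ^ n ≠ 1) :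
    Function.Injective (casimirValue q) := by
  intro m n h
  by_contra hmn
  have h0 : (q : ℂ) ≠ 0 := q.ne_zero
  have h1 := sub_inv_ne_zero hq
  rw [casimirValue, casimirValue, div_left_inj' (pow_ne_zero 2 h1), zpow_neg, zpow_neg] at h
  have hx : (q : ℂ) ^ ((m : ℤ) + 1) ≠ 0 := zpow_ne_zero _ h0
  have hy : (q : ℂ) ^ ((n : ℤ) + 1) ≠ 0 := zpow_ne_zero _ h0
  have h2 : (q : ℂ) ^ ((m : ℤ) + 1) - (q : ℂ) ^ ((n : ℤ) + 1) ≠ 0 :=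
    sub_ne_zero.2 ((zpow_injective hq).ne (by omega))
  have h3 : (q : ℂ) ^ ((m : ℤ) + 1) * (q : ℂ) ^ ((n : ℤ) + 1) - 1 ≠ 0 := by
    rw [← zpow_add₀ h0]
    exact sub_ne_zero.2 (zpow_ne_one hq (by omega))
  apply mul_ne_zero h2 h3
  field_simp at h
  linear_combination h

end V

/-- The Casimir element of `U_q(sl₂)`. -/
def Uq.casimir (q : ℂˣ) : Uq q :=
  Uq.F q * Uq.E q + (((q : ℂ) - (q : ℂ)⁻¹) ^ 2)⁻¹ • ((q : ℂ) • Uq.K q + (q : ℂ)⁻¹ • Uq.Kinv q)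

namespace V

variable {m : ℕ}

/-- `F E` acts on the weight vector `v_i` by `[i] [m - i + 1]`. After expansion, the terms depending
on `i` cancel against the contributions of `K` and `K⁻¹`. -/
theorem rep_casimir (hq : ∀ n : ℕ, 0 < n → q ^ n ≠ 1) (f : V m) (i : Fin (m + 1)) :
    rep q m (Uq.casimir q) f i = casimirValue q m * f i := by
  have h0 : (q : ℂ) ≠ 0 := q.ne_zero
  have h1 := sub_inv_ne_zero hq
  have hFE : (opF q m (opE q m f)) i = qInt q i * qInt q (m - i + 1) * f i := by
    obtain ⟨i, hi⟩ := i
    rw [opF_apply]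
    rcases i with _ | i
    · simp [qInt]
    · simp only [opE_apply]
      rw [if_pos (by omega), dif_pos (by simp; omega)]
      simp only [Nat.add_sub_cancel, Nat.cast_add, Nat.cast_one]
      rw [mul_assoc]
      ring_nf
  have key : qInt q i * qInt q (m - i + 1) + (((q : ℂ) - (q : ℂ)⁻¹) ^ 2)⁻¹ *
      (q * (q : ℂ) ^ ((m : ℤ) - 2 * i) + (q : ℂ)⁻¹ * (q : ℂ) ^ (-((m : ℤ) - 2 * i))) =
      casimirValue q m := by
    have h : ((q : ℂ) ^ (i : ℤ) - (q : ℂ) ^ (-(i : ℤ))) *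
        ((q : ℂ) ^ ((m : ℤ) - i + 1) - (q : ℂ) ^ (-((m : ℤ) - i + 1))) +
        (q * (q : ℂ) ^ ((m : ℤ) - 2 * i) + (q : ℂ)⁻¹ * (q : ℂ) ^ (-((m : ℤ) - 2 * i))) =
        (q : ℂ) ^ ((m : ℤ) + 1) + (q : ℂ) ^ (-((m : ℤ) + 1)) := by
      rw [← zpow_neg_one (q : ℂ)]
      nth_rewrite 5 [← zpow_one (q : ℂ)]
      simp only [sub_mul, mul_sub, ← zpow_add₀ h0]
      ring_nf
    rw [casimirValue, ← h, qInt, qInt]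
    field_simp
  rw [← key]
  simp only [Uq.casimir, map_add, map_mul, map_smul, rep_gen, opGen, LinearMap.add_apply,
    Module.End.mul_apply, LinearMap.smul_apply, Pi.add_apply, Pi.smul_apply, smul_eq_mul, hFE,
    opK_apply, opKinv_apply]
  ring

/-- A nonzero multiple of any matrix unit of `V m` comes from an element of `U_q(sl₂)` which
annihilates finitely many given other modules. -/
theorem exists_rep_matrixUnit (hq : ∀ n : ℕ, 0 < n → q ^ n ≠ 1) (m : ℕ) (i j : Fin (m + 1))
    (s : Finset ℕ) : ∃ u : Uq q, ∃ c : ℂ, c ≠ 0 ∧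
      (∀ f, rep q m u f = (c * f j) • Pi.single i 1) ∧ ∀ n ∈ s, n ≠ m → rep q n u = 0 := by
  -- Evaluated at the Casimir element, `p` kills the unwanted modules. Evaluated at `K`, `r` kills
  -- every weight of `V m` except the highest. The element sought is `p(C) F ^ i r(K) E ^ j`, with
  -- `C` the Casimir element: `E ^ j` raises `v_j` to the highest weight line, `r(K)` projects onto
  -- that line, and `F ^ i` descends to `v_i`.
  let p : Polynomial ℂ := ∏ n ∈ s.erase m, (Polynomial.X - Polynomial.C (casimirValue q n))
  let r : Polynomial ℂ := ∏ k ∈ Finset.range m,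
    (Polynomial.X - Polynomial.C ((q : ℂ) ^ ((m : ℤ) - 2 * (k + 1))))
  have hp (n : ℕ) (f : V n) : rep q n (Polynomial.aeval (Uq.casimir q) p) f =
      p.eval (casimirValue q n) • f := by
    ext i
    rw [← Polynomial.aeval_algHom_apply,
      aeval_apply_of_diagonal (μ := fun _ => casimirValue q n) (rep_casimir hq)]
    rfl
  have hr (f : V m) : rep q m (Polynomial.aeval (Uq.K q) r) f =
      (r.eval ((q : ℂ) ^ (m : ℤ)) * f 0) • Pi.single 0 1 := by
    ext i
    rw [← Polynomial.aeval_algHom_apply,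
      aeval_apply_of_diagonal (ι := Fin (m + 1)) (T := rep q m (Uq.K q))
        (μ := fun i => (q : ℂ) ^ ((m : ℤ) - 2 * (i : ℕ))) (by intro f i; rw [rep_gen]; rfl)]
    refine Fin.cases ?_ (fun k => ?_) i
    · simp
    · have : r.eval ((q : ℂ) ^ ((m : ℤ) - 2 * (k.succ : ℕ))) = 0 := by
        rw [Polynomial.eval_prod]
        exact Finset.prod_eq_zero (Finset.mem_range.2 k.2) (by simp)
      rw [this]
      simp
  have hp0 : p.eval (casimirValue q m) ≠ 0 := by
    rw [Polynomial.eval_prod, Finset.prod_ne_zero_iff]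
    intro n hn
    simpa [sub_eq_zero] using (casimirValue_injective hq).ne (Finset.ne_of_mem_erase hn).symm
  have hr0 : r.eval ((q : ℂ) ^ (m : ℤ)) ≠ 0 := by
    rw [Polynomial.eval_prod, Finset.prod_ne_zero_iff]
    intro k _
    rw [Polynomial.eval_sub, Polynomial.eval_X, Polynomial.eval_C, sub_ne_zero]
    exact (zpow_injective hq).ne (by omega)
  have hE0 : ∏ k ∈ Finset.range j, qInt q (m - k) ≠ 0 :=
    Finset.prod_ne_zero_iff.2 fun k hk => qInt_ne_zero hq (by
      have := Finset.mem_range.1 hk; omega)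
  have hF0 : ∏ k ∈ Finset.range i, qInt q (k + 1) ≠ 0 :=
    Finset.prod_ne_zero_iff.2 fun k _ => qInt_ne_zero hq (by omega)
  refine ⟨Polynomial.aeval (Uq.casimir q) p *
    (Uq.F q ^ (i : ℕ) * (Polynomial.aeval (Uq.K q) r * Uq.E q ^ (j : ℕ))), _,
    mul_ne_zero (mul_ne_zero (mul_ne_zero hp0 hr0) hE0) hF0, fun f => ?_, fun n hn hnm => ?_⟩
  · simp only [map_mul, Module.End.mul_apply, hp, map_pow, rep_gen, opGen, hr, opE_pow_apply_zero,
      map_smul, opF_pow_single_zero, smul_smul]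
    congr 1
    ring
  · rw [map_mul]
    have : p.eval (casimirValue q n) = 0 := by
      rw [Polynomial.eval_prod]
      exact Finset.prod_eq_zero (Finset.mem_erase.2 ⟨hnm, hn⟩) (by simp)
    refine LinearMap.ext fun f => ?_
    rw [Module.End.mul_apply, hp, this, zero_smul, LinearMap.zero_apply]

end V

/-! ### Linear independence of matrix coefficients -/

/-- The matrix coefficients of the modules `V m` with respect to their standard bases. -/
def basisCoeff (q : ℂˣ) (p : Σ m : ℕ, Fin (m + 1) × Fin (m + 1)) : Module.Dual ℂ (Uq q) :=
  matrixCoeff q p.1 (LinearMap.proj p.2.1) (Pi.single p.2.2 1)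

/-- Evaluating a linear relation at the element of `exists_rep_matrixUnit` for one index leaves only
the term of that index, with a nonzero factor. -/
theorem linearIndependent_basisCoeff {q : ℂˣ} (hq : ∀ n : ℕ, 0 < n → q ^ n ≠ 1) :
    LinearIndependent ℂ (basisCoeff q) := by
  rw [linearIndependent_iff']
  rintro s g hg ⟨m, i, j⟩ hp
  obtain ⟨u, c, hc, hu, hu'⟩ := V.exists_rep_matrixUnit hq m i j (s.image Sigma.fst)
  have h := LinearMap.congr_fun hg u
  rw [LinearMap.sum_apply, Finset.sum_eq_single_of_mem _ hp] at h
  · simpa [basisCoeff, hu, hc] using h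
  · rintro ⟨n, k, l⟩ hk hne
    by_cases hn : n = m
    · subst hn
      by_cases hik : k = i
      · have hjl : j ≠ l := by rintro rfl; exact hne (by rw [hik])
        simp [basisCoeff, hu, hjl]
      · simp [basisCoeff, hu, hik]
    · simp [basisCoeff, hu' n (Finset.mem_image.2 ⟨_, hk, rfl⟩) hn]

theorem span_basisCoeff (q : ℂˣ) (m : ℕ) :
    coeffSpace q m = Submodule.span ℂ (basisCoeff q '' {p | p.1 = m}) := by
  apply le_antisymm
  · rw [coeffSpace, Submodule.span_le]
    rintro _ ⟨φ, v, rfl⟩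
    have : matrixCoeff q m φ v = ∑ i, ∑ j, (φ (Pi.single i 1) * v j) • basisCoeff q ⟨m, i, j⟩ := by
      ext u
      have hφ (w : V m) : φ w = ∑ i, φ (Pi.single i 1) * w i := by
        conv_lhs => rw [pi_eq_sum_univ' w, map_sum]
        exact Finset.sum_congr rfl fun i _ => by rw [map_smul, smul_eq_mul, mul_comm]
      have hv : V.rep q m u v = ∑ j, v j • V.rep q m u (Pi.single j 1) := by
        conv_lhs => rw [pi_eq_sum_univ' v, map_sum]
        exact Finset.sum_congr rfl fun i _ => by rw [map_smul]
      rw [matrixCoeff_apply, hφ, hv]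
      simp [basisCoeff, Finset.sum_apply, Finset.mul_sum, mul_assoc]
    rw [this]
    exact Submodule.sum_mem _ fun i _ => Submodule.sum_mem _ fun j _ =>
      Submodule.smul_mem _ _ (Submodule.subset_span ⟨_, rfl, rfl⟩)
  · rw [Submodule.span_le]
    rintro _ ⟨⟨_, i, j⟩, rfl, rfl⟩
    exact Submodule.subset_span ⟨_, _, rfl⟩

/-! ### Ordered monomials and degree in `O_q(Mat₂)` -/

namespace OqMat2
/-- The span of the ordered monomials of degree `n` in `O_q(Mat₂)`. -/
def homogeneous (q : ℂˣ) (n : ℕ) : Submodule ℂ (OqMat2 q) :=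
  Submodule.span ℂ ((fun f : Fin 4 →₀ ℕ => a q ^ f 0 * (b q ^ f 1 * (c q ^ f 2 * d q ^ f 3))) ''
    (Finset.finsuppAntidiag Finset.univ n : Finset (Fin 4 →₀ ℕ)))

theorem monomial_mem {i j k l n : ℕ} (h : i + j + k + l = n) :
    a q ^ i * (b q ^ j * (c q ^ k * d q ^ l)) ∈ homogeneous q n := by
  apply Submodule.subset_span
  refine ⟨Finsupp.equivFunOnFinite.symm ![i, j, k, l], ?_, by simp⟩
  simp [Finset.mem_finsuppAntidiag, Fin.sum_univ_four, h]

theorem homogeneous_induction {n : ℕ} {p : ∀ x : OqMat2 q, x ∈ homogeneous q n → Prop}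
    (mon : ∀ (i j k l : ℕ) (h : i + j + k + l = n), p _ (monomial_mem h))
    (zero : p 0 (zero_mem _))
    (add : ∀ x y hx hy, p x hx → p y hy → p (x + y) (add_mem hx hy))
    (smul : ∀ (r : ℂ) x hx, p x hx → p (r • x) (Submodule.smul_mem _ r hx))
    {x : OqMat2 q} (hx : x ∈ homogeneous q n) : p x hx := by
  refine Submodule.span_induction ?_ zero add smul hx
  rintro _ ⟨f, hf, rfl⟩
  apply mon
  simpa [Finset.mem_finsuppAntidiag, Fin.sum_univ_four] using hf

theorem finrank_homogeneous_le (q : ℂˣ) (n : ℕ) :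
    Module.finrank ℂ (homogeneous q n) ≤ (n + 3).choose 3 := by
  classical
  rw [homogeneous, ← Finset.coe_image]
  refine (finrank_span_finset_le_card _).trans (Finset.card_image_le.trans ?_)
  rw [Finset.card_finsuppAntidiag_nat_eq_choose]
  simp only [Finset.card_univ, Fintype.card_fin, show 4 + n - 1 = n + 3 by omega]
  exact Nat.choose_symm_add.le

instance (n : ℕ) : FiniteDimensional ℂ (homogeneous q n) :=
  FiniteDimensional.span_of_finite ℂ ((Finset.finite_toSet _).image _)

/-- Commutation up to a scalar. -/
theorem mul_pow_of_mul_eq_smul {B : Type*} [Ring B] [Algebra ℂ B] {x y : B} {r : ℂ}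
    (h : x * y = r • (y * x)) (n : ℕ) : x * y ^ n = r ^ n • (y ^ n * x) := by
  induction n with
  | zero => simp
  | succ n ih =>
    rw [pow_succ y, ← mul_assoc, ih, smul_mul_assoc, mul_assoc, h, mul_smul_comm, smul_smul,
      ← mul_assoc, pow_succ r]

theorem b_mul_a : b q * a q = (q : ℂ)⁻¹ • (a q * b q) := by
  rw [a_mul_b, smul_smul, inv_mul_cancel₀ q.ne_zero, one_smul]

theorem c_mul_a : c q * a q = (q : ℂ)⁻¹ • (a q * c q) := by
  rw [a_mul_c, smul_smul, inv_mul_cancel₀ q.ne_zero, one_smul]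

theorem d_mul_b : d q * b q = (q : ℂ)⁻¹ • (b q * d q) := by
  rw [b_mul_d, smul_smul, inv_mul_cancel₀ q.ne_zero, one_smul]

theorem d_mul_c : d q * c q = (q : ℂ)⁻¹ • (c q * d q) := by
  rw [c_mul_d, smul_smul, inv_mul_cancel₀ q.ne_zero, one_smul]

theorem b_mul_c_mul_a : b q * c q * a q = ((q : ℂ)⁻¹) ^ 2 • (a q * (b q * c q)) := by
  rw [mul_assoc, c_mul_a, mul_smul_comm, ← mul_assoc, b_mul_a, smul_mul_assoc, smul_smul,
    mul_assoc, sq]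

/-- Only the pair `a, d` fails to commute up to a scalar. Moving `d` across a power of `a` costs a
single correction term of the same degree. Its coefficient is irrelevant for spanning, hence left
existential. -/
theorem exists_d_mul_a_pow (n : ℕ) : ∃ r : ℂ,
    d q * a q ^ (n + 1) = a q ^ (n + 1) * d q + r • (a q ^ n * (b q * c q)) := by
  have h : d q * a q = a q * d q + (-((q : ℂ) - (q : ℂ)⁻¹)) • (b q * c q) := by
    rw [a_mul_d]; module
  induction n with
  | zero => exact ⟨_, by simpa using h⟩
  | succ n ih =>
    obtain ⟨r, hr⟩ := ih
    refine ⟨-((q : ℂ) - (q : ℂ)⁻¹) + r * ((q : ℂ)⁻¹) ^ 2, ?_⟩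
    rw [pow_succ _ (n + 1), ← mul_assoc, hr, add_mul, mul_assoc, h, smul_mul_assoc,
      mul_assoc _ _ (a q), b_mul_c_mul_a, mul_smul_comm, mul_add, mul_smul_comm, ← mul_assoc (a q ^ n), ← pow_succ,
      ← mul_assoc]
    module

theorem b_mul_mem {n : ℕ} {x : OqMat2 q} (hx : x ∈ homogeneous q n) :
    b q * x ∈ homogeneous q (n + 1) := by
  induction hx using homogeneous_induction with
  | mon i j k l h =>
    rw [← mul_assoc, mul_pow_of_mul_eq_smul b_mul_a, smul_mul_assoc, mul_assoc,
      ← mul_assoc (b q), ← pow_succ']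
    exact Submodule.smul_mem _ _ (monomial_mem (by omega))
  | zero => simp
  | add x y _ _ hx hy => rw [mul_add]; exact add_mem hx hy
  | smul r x _ hx => rw [mul_smul_comm]; exact Submodule.smul_mem _ _ hx

theorem c_mul_b_pow (j : ℕ) : c q * b q ^ j = b q ^ j * c q :=
  Commute.pow_right (show Commute (c q) (b q) from c_mul_b) j

theorem c_mul_mem {n : ℕ} {x : OqMat2 q} (hx : x ∈ homogeneous q n) :
    c q * x ∈ homogeneous q (n + 1) := by
  induction hx using homogeneous_induction with
  | mon i j k l h =>
    rw [← mul_assoc, mul_pow_of_mul_eq_smul c_mul_a, smul_mul_assoc, mul_assoc,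
      ← mul_assoc (c q), c_mul_b_pow, mul_assoc, ← mul_assoc (c q), ← pow_succ']
    exact Submodule.smul_mem _ _ (monomial_mem (by omega))
  | zero => simp
  | add x y _ _ hx hy => rw [mul_add]; exact add_mem hx hy
  | smul r x _ hx => rw [mul_smul_comm]; exact Submodule.smul_mem _ _ hx

theorem a_mul_mem {n : ℕ} {x : OqMat2 q} (hx : x ∈ homogeneous q n) :
    a q * x ∈ homogeneous q (n + 1) := by
  induction hx using homogeneous_induction with
  | mon i j k l h =>
    rw [← mul_assoc, ← pow_succ']
    exact monomial_mem (by omega)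
  | zero => simp
  | add x y _ _ hx hy => rw [mul_add]; exact add_mem hx hy
  | smul r x _ hx => rw [mul_smul_comm]; exact Submodule.smul_mem _ _ hx

theorem d_mul_b_pow_mul (j k l : ℕ) : d q * (b q ^ j * (c q ^ k * d q ^ l)) =
    ((q : ℂ)⁻¹ ^ j * (q : ℂ)⁻¹ ^ k) • (b q ^ j * (c q ^ k * d q ^ (l + 1))) := by
  rw [← mul_assoc, mul_pow_of_mul_eq_smul d_mul_b, smul_mul_assoc, mul_assoc, ← mul_assoc (d q),
    mul_pow_of_mul_eq_smul d_mul_c, smul_mul_assoc, mul_smul_comm, smul_smul, mul_assoc _ (d q),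
    ← pow_succ']

theorem d_mul_mem {n : ℕ} {x : OqMat2 q} (hx : x ∈ homogeneous q n) :
    d q * x ∈ homogeneous q (n + 1) := by
  induction hx using homogeneous_induction with
  | mon i j k l h =>
    -- Without a factor `a` to cross, `d` only picks up scalars. Otherwise the correction term adds
    -- one `b` and one `c` and removes one `a`.
    rcases i with _ | i
    · rw [pow_zero, one_mul, d_mul_b_pow_mul]
      refine Submodule.smul_mem _ _ ?_
      simpa using monomial_mem (q := q) (i := 0) (j := j) (k := k) (l := l + 1) (n := n + 1)
        (by omega)
    · obtain ⟨r, hr⟩ := exists_d_mul_a_pow (q := q) i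
      rw [← mul_assoc, hr, add_mul, mul_assoc, d_mul_b_pow_mul, mul_smul_comm, smul_mul_assoc]
      refine add_mem (Submodule.smul_mem _ _ (monomial_mem (by omega)))
        (Submodule.smul_mem _ _ ?_)
      rw [mul_assoc, mul_assoc, ← mul_assoc (c q), c_mul_b_pow, mul_assoc, ← mul_assoc (c q),
        ← pow_succ', ← mul_assoc (b q), ← pow_succ']
      exact monomial_mem (by omega)
  | zero => simp
  | add x y _ _ hx hy => rw [mul_add]; exact add_mem hx hy
  | smul r x _ hx => rw [mul_smul_comm]; exact Submodule.smul_mem _ _ hx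

theorem gen_mul_mem (g : MatGen) {n : ℕ} {x : OqMat2 q} (hx : x ∈ homogeneous q n) :
    gen q g * x ∈ homogeneous q (n + 1) := by
  cases g
  exacts [a_mul_mem hx, b_mul_mem hx, c_mul_mem hx, d_mul_mem hx]

theorem one_mem_homogeneous : (1 : OqMat2 q) ∈ homogeneous q 0 := by
  simpa using monomial_mem (q := q) (i := 0) (j := 0) (k := 0) (l := 0) rfl

theorem qdet_mul_mem {n : ℕ} {x : OqMat2 q} (hx : x ∈ homogeneous q n) :
    qdet q * x ∈ homogeneous q (n + 2) := by
  rw [qdet, sub_mul, smul_mul_assoc, mul_assoc, mul_assoc]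
  exact sub_mem (gen_mul_mem _ (gen_mul_mem _ hx))
    (Submodule.smul_mem _ _ (gen_mul_mem _ (gen_mul_mem _ hx)))

/-- The sum of the degree pieces contains `1` and is stable under left multiplication by generators,
hence by everything. That the sum is direct is not needed. -/
theorem iSup_homogeneous : ⨆ n, homogeneous q n = ⊤ := by
  have hmul (g : MatGen) (x : OqMat2 q) (hx : x ∈ ⨆ n, homogeneous q n) :
      gen q g * x ∈ ⨆ n, homogeneous q n := by
    induction hx using Submodule.iSup_induction' with
    | mem n x hx => exact Submodule.mem_iSup_of_mem (n + 1) (gen_mul_mem g hx)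
    | zero => simp
    | add x y _ _ hx hy => rw [mul_add]; exact add_mem hx hy
  have h (x : FreeAlgebra ℂ MatGen) (y : OqMat2 q) (hy : y ∈ ⨆ n, homogeneous q n) :
      mk q x * y ∈ ⨆ n, homogeneous q n := by
    induction x using FreeAlgebra.induction generalizing y with
    | grade0 r =>
      rw [AlgHom.commutes, ← Algebra.smul_def]
      exact Submodule.smul_mem _ _ hy
    | grade1 g => exact hmul g y hy
    | mul x x' hx hx' => rw [map_mul, mul_assoc]; exact hx _ (hx' _ hy)
    | add x x' hx hx' => rw [map_add, add_mul]; exact add_mem (hx _ hy) (hx' _ hy)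
  rw [eq_top_iff]
  rintro x -
  obtain ⟨x, rfl⟩ := RingQuot.mkAlgHom_surjective ℂ (MatRel q) x
  have := h x 1 (Submodule.mem_iSup_of_mem 0 one_mem_homogeneous)
  rwa [mul_one] at this

end OqMat2

/-! ### The embedding of `V (m + 1)` into `V 1 ⊗ V m` -/

namespace V
/-- The embedding of `V (m + 1)` into `V 1 ⊗ V m`. -/
def embed (q : ℂˣ) (m : ℕ) : V (m + 1) →ₗ[ℂ] V 1 ⊗[ℂ] V m :=
  TensorProduct.mk ℂ (V 1) (V m) (Pi.single 0 1) ∘ₗ LinearMap.funLeft ℂ ℂ Fin.castSucc +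
  TensorProduct.mk ℂ (V 1) (V m) (Pi.single 1 1) ∘ₗ
    LinearMap.pi fun k : Fin (m + 1) => (q : ℂ) ^ ((k : ℤ) - m) • LinearMap.proj k.succ

theorem embed_apply (m : ℕ) (f : V (m + 1)) : embed q m f =
    (Pi.single 0 1 : V 1) ⊗ₜ ((fun k => f k.castSucc : V m)) +
      (Pi.single 1 1 : V 1) ⊗ₜ ((fun k => (q : ℂ) ^ ((k : ℤ) - m) * f k.succ : V m)) := rfl

/-- The action of `U_q(sl₂)` on `V 1 ⊗ V m`. -/
def tensorRep (q : ℂˣ) (m : ℕ) : Uq q →ₐ[ℂ] Module.End ℂ (V 1 ⊗[ℂ] V m) :=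
  Module.endTensorEndAlgHom.comp
    ((Algebra.TensorProduct.map (rep q 1) (rep q m)).comp (Uq.comul q))

theorem tensorRep_E (m : ℕ) (v : V 1) (w : V m) :
    tensorRep q m (Uq.E q) (v ⊗ₜ w) = opE q 1 v ⊗ₜ w + opK q 1 v ⊗ₜ opE q m w := by
  simp only [tensorRep, AlgHom.comp_apply, Uq.comul_gen, Uq.comulGen, map_add,
    Algebra.TensorProduct.map_tmul, rep_gen, map_one, LinearMap.add_apply,
    Module.endTensorEndAlgHom_apply]
  rfl

theorem tensorRep_F (m : ℕ) (v : V 1) (w : V m) :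
    tensorRep q m (Uq.F q) (v ⊗ₜ w) = opF q 1 v ⊗ₜ opKinv q m w + v ⊗ₜ opF q m w := by
  simp only [tensorRep, AlgHom.comp_apply, Uq.comul_gen, Uq.comulGen, map_add,
    Algebra.TensorProduct.map_tmul, rep_gen, map_one, LinearMap.add_apply,
    Module.endTensorEndAlgHom_apply]
  rfl

theorem tensorRep_K (m : ℕ) (v : V 1) (w : V m) :
    tensorRep q m (Uq.K q) (v ⊗ₜ w) = opK q 1 v ⊗ₜ opK q m w := by
  simp only [tensorRep, AlgHom.comp_apply, Uq.comul_gen, Uq.comulGen,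
    Algebra.TensorProduct.map_tmul, rep_gen, Module.endTensorEndAlgHom_apply]
  rfl

theorem sub_inv_mul_qInt (hq : ∀ n : ℕ, 0 < n → q ^ n ≠ 1) (n : ℤ) :
    ((q : ℂ) - (q : ℂ)⁻¹) * qInt q n = (q : ℂ) ^ n - (q : ℂ) ^ (-n) :=
  mul_div_cancel₀ _ (sub_inv_ne_zero hq)

/-- This recurrence and the next are what equivariance under `E` and `F` requires. The summand `q ^
(-n)` at `n = m - k` is the coefficient `q ^ (k - m)` in `embed`. -/
theorem qInt_add_one (hq : ∀ n : ℕ, 0 < n → q ^ n ≠ 1) (n : ℤ) :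
    qInt q (n + 1) = q * qInt q n + (q : ℂ) ^ (-n) := by
  have h0 : (q : ℂ) ≠ 0 := q.ne_zero
  apply mul_left_cancel₀ (sub_inv_ne_zero hq)
  rw [mul_add, mul_left_comm, sub_inv_mul_qInt hq, sub_inv_mul_qInt hq, neg_add, zpow_add₀ h0,
    zpow_add₀ h0, zpow_one, zpow_neg_one]
  ring

theorem qInt_add_one' (hq : ∀ n : ℕ, 0 < n → q ^ n ≠ 1) (n : ℤ) :
    qInt q (n + 1) = (q : ℂ)⁻¹ * qInt q n + (q : ℂ) ^ n := by
  have h0 : (q : ℂ) ≠ 0 := q.ne_zero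
  apply mul_left_cancel₀ (sub_inv_ne_zero hq)
  rw [mul_add, mul_left_comm, sub_inv_mul_qInt hq, sub_inv_mul_qInt hq, neg_add, zpow_add₀ h0,
    zpow_add₀ h0, zpow_one, zpow_neg_one]
  ring

theorem qInt_one (hq : ∀ n : ℕ, 0 < n → q ^ n ≠ 1) : qInt q 1 = 1 := by
  rw [qInt, zpow_one, zpow_neg_one, div_self (sub_inv_ne_zero hq)]

theorem embed_opE (hq : ∀ n : ℕ, 0 < n → q ^ n ≠ 1) (m : ℕ) (f : V (m + 1)) :
    embed q m (opE q (m + 1) f) = tensorRep q m (Uq.E q) (embed q m f) := by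
  have h0 : (q : ℂ) ≠ 0 := q.ne_zero
  have e1 : (fun k : Fin (m + 1) => opE q (m + 1) f k.castSucc) =
      (fun k : Fin (m + 1) => (q : ℂ) ^ ((k : ℤ) - m) * f k.succ) +
        (q : ℂ) • opE q m fun k => f k.castSucc := by
    ext k
    simp only [opE_apply, Pi.add_apply, Pi.smul_apply, smul_eq_mul, Fin.val_castSucc, k.2, dif_pos]
    have e : ((m + 1 : ℕ) : ℤ) - (k : ℕ) = (m - (k : ℕ)) + 1 := by push_cast; ring
    rw [e, qInt_add_one hq, neg_sub, add_mul, add_comm]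
    congr 1
    -- At the boundary `k = m`, `E` returns `0` by definition, in agreement with `[0] = 0`.
    split_ifs with h
    · rw [mul_assoc]; rfl
    · have : (m : ℤ) - (k : ℕ) = 0 := by omega
      rw [this]
      simp [qInt]
  have e2 : (fun k : Fin (m + 1) => (q : ℂ) ^ ((k : ℤ) - m) * opE q (m + 1) f k.succ) =
      (q : ℂ)⁻¹ • opE q m fun k => (q : ℂ) ^ ((k : ℤ) - m) * f k.succ := by
    ext k
    simp only [opE_apply, Pi.smul_apply, smul_eq_mul, Fin.val_succ]
    by_cases h : (k : ℕ) < m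
    · rw [dif_pos (by omega), dif_pos h]
      have : (q : ℂ)⁻¹ * (q : ℂ) ^ (((k + 1 : ℕ) : ℤ) - m) = (q : ℂ) ^ ((k : ℤ) - m) := by
        rw [← zpow_neg_one, ← zpow_add₀ h0]
        congr 1; push_cast; ring
      rw [← this]
      push_cast
      rw [add_sub_add_right_eq_sub]
      simp only [Fin.succ_mk]
      ring
    · rw [dif_neg (by omega), dif_neg h]; simp
  have h1 : opE q 1 (Pi.single 0 1) = 0 := Pairing.opE_e0
  have h2 : opE q 1 (Pi.single 1 1) = Pi.single 0 1 := by
    rw [Pairing.opE_e1, qInt_one hq, one_smul]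
  have h3 : opK q 1 (Pi.single 0 1) = (q : ℂ) • Pi.single 0 1 := Pairing.opK_e0
  have h4 : opK q 1 (Pi.single 1 1) = (q : ℂ)⁻¹ • Pi.single 1 1 := Pairing.opK_e1
  rw [embed_apply, embed_apply, e1, e2]
  simp [tensorRep_E, h1, h2, h3, h4, TensorProduct.tmul_add,
    ← TensorProduct.smul_tmul', add_assoc]
  exact add_left_comm _ _ _

theorem embed_opF (hq : ∀ n : ℕ, 0 < n → q ^ n ≠ 1) (m : ℕ) (f : V (m + 1)) :
    embed q m (opF q (m + 1) f) = tensorRep q m (Uq.F q) (embed q m f) := by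
  have h0 : (q : ℂ) ≠ 0 := q.ne_zero
  have e1 : (fun k : Fin (m + 1) => opF q (m + 1) f k.castSucc) =
      opF q m fun k => f k.castSucc := by
    ext k
    simp only [opF_apply, Fin.val_castSucc]
    rfl
  have e2 : (fun k : Fin (m + 1) => (q : ℂ) ^ ((k : ℤ) - m) * opF q (m + 1) f k.succ) =
      (opKinv q m fun k => f k.castSucc) +
        opF q m fun k => (q : ℂ) ^ ((k : ℤ) - m) * f k.succ := by
    ext k
    simp only [opF_apply, opKinv_apply, Pi.add_apply, Fin.val_succ]
    rw [if_pos (by omega)]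
    push_cast
    rw [qInt_add_one' hq]
    have e : (q : ℂ) ^ (-((m : ℤ) - 2 * (k : ℕ))) =
        (q : ℂ) ^ ((k : ℤ) - m) * (q : ℂ) ^ (k : ℤ) := by
      rw [← zpow_add₀ h0]
      congr 1; ring
    rw [e]
    obtain ⟨k, hk⟩ := k
    rcases k with _ | k
    · simp [qInt]
    · have : (q : ℂ) ^ (((k + 1 : ℕ) : ℤ) - m) * (q : ℂ)⁻¹ = (q : ℂ) ^ ((k : ℤ) - m) := by
        rw [← zpow_neg_one, ← zpow_add₀ h0]
        congr 1; push_cast; ring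
      simp only [Nat.zero_lt_succ, if_true, Nat.add_sub_cancel, Fin.succ_mk, Fin.castSucc_mk,
        ← this]
      ring
  have h1 : opF q 1 (Pi.single 0 1) = Pi.single 1 1 := by
    rw [Pairing.opF_e0, qInt_one hq, one_smul]
  have h2 : opF q 1 (Pi.single 1 1) = 0 := Pairing.opF_e1
  rw [embed_apply, embed_apply, e1, e2]
  simp [tensorRep_F, h1, h2, TensorProduct.tmul_add]
  abel

theorem embed_opK (m : ℕ) (f : V (m + 1)) :
    embed q m (opK q (m + 1) f) = tensorRep q m (Uq.K q) (embed q m f) := by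
  have h0 : (q : ℂ) ≠ 0 := q.ne_zero
  have e1 : (fun k : Fin (m + 1) => opK q (m + 1) f k.castSucc) =
      (q : ℂ) • opK q m fun k => f k.castSucc := by
    ext k
    simp only [opK_apply, Fin.val_castSucc, Pi.smul_apply, smul_eq_mul]
    rw [← mul_assoc, ← zpow_one_add₀ h0]
    congr 2; push_cast; ring
  have e2 : (fun k : Fin (m + 1) => (q : ℂ) ^ ((k : ℤ) - m) * opK q (m + 1) f k.succ) =
      (q : ℂ)⁻¹ • opK q m fun k => (q : ℂ) ^ ((k : ℤ) - m) * f k.succ := by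
    ext k
    simp only [opK_apply, Fin.val_succ, Pi.smul_apply, smul_eq_mul]
    rw [mul_left_comm, mul_left_comm (q : ℂ)⁻¹]
    simp only [← mul_assoc]
    congr 1
    rw [← zpow_neg_one, ← zpow_add₀ h0, ← zpow_add₀ h0, ← zpow_add₀ h0]
    congr 1; push_cast; ring
  have h3 : opK q 1 (Pi.single 0 1) = (q : ℂ) • Pi.single 0 1 := Pairing.opK_e0
  have h4 : opK q 1 (Pi.single 1 1) = (q : ℂ)⁻¹ • Pi.single 1 1 := Pairing.opK_e1
  rw [embed_apply, embed_apply, e1, e2]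
  simp [tensorRep_K, h3, h4, ← TensorProduct.smul_tmul']

theorem embed_rep (hq : ∀ n : ℕ, 0 < n → q ^ n ≠ 1) (m : ℕ) (u : Uq q) (f : V (m + 1)) :
    embed q m (rep q (m + 1) u f) = tensorRep q m u (embed q m f) := by
  have hK (f : V (m + 1)) :
      embed q m (rep q (m + 1) (Uq.K q) f) = tensorRep q m (Uq.K q) (embed q m f) := by
    rw [rep_gen]; exact embed_opK m f
  obtain ⟨u, rfl⟩ := Uq.mk_surjective u
  induction u using FreeAlgebra.induction generalizing f with
  | grade0 r => simp [AlgHom.commutes, Module.algebraMap_end_apply]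
  | grade1 x =>
    change embed q m (rep q (m + 1) (Uq.gen q x) f) = tensorRep q m (Uq.gen q x) (embed q m f)
    cases x
    · rw [rep_gen]; exact embed_opE hq m f
    · rw [rep_gen]; exact embed_opF hq m f
    · exact hK f
    -- Equivariance under `K⁻¹` follows from that under `K`, applied to `K⁻¹ f`.
    · have h := congrArg (tensorRep q m (Uq.Kinv q)) (hK (rep q (m + 1) (Uq.Kinv q) f))
      rw [← Module.End.mul_apply, ← map_mul, Uq.K_mul_Kinv, map_one, Module.End.one_apply,
        ← Module.End.mul_apply, ← map_mul, Uq.Kinv_mul_K, map_one, Module.End.one_apply] at h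
      exact h.symm
  | mul x y hx hy => simp only [map_mul, Module.End.mul_apply, hx, hy]
  | add x y hx hy => simp only [map_add, LinearMap.add_apply, hx, hy]

/-- The tensor product of functionals on `V 1` and `V m`. -/
def tensorFun {m : ℕ} (φ : Module.Dual ℂ (V 1)) (ψ : Module.Dual ℂ (V m)) :
    V 1 ⊗[ℂ] V m →ₗ[ℂ] ℂ :=
  LinearMap.mul' ℂ ℂ ∘ₗ TensorProduct.map φ ψ

theorem matrixCoeff_mul {m : ℕ} (φ : Module.Dual ℂ (V 1)) (ψ : Module.Dual ℂ (V m)) (v : V 1)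
    (w : V m) (u : Uq q) :
    (WithConv.toConv (matrixCoeff q 1 φ v) * WithConv.toConv (matrixCoeff q m ψ w)) u =
      tensorFun φ ψ (tensorRep q m u (v ⊗ₜ w)) := by
  have h (t : Uq q ⊗[ℂ] Uq q) :
      LinearMap.mul' ℂ ℂ (TensorProduct.map (matrixCoeff q 1 φ v) (matrixCoeff q m ψ w) t) =
      tensorFun φ ψ (Module.endTensorEndAlgHom (R := ℂ) (S := ℂ)
        (A := ℂ) (Algebra.TensorProduct.map (rep q 1) (rep q m) t) (v ⊗ₜ w)) := by
    induction t with
    | zero => simp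
    | tmul x y =>
      rw [Algebra.TensorProduct.map_tmul, Module.endTensorEndAlgHom_apply]
      simp [tensorFun]
    | add x y hx hy => simp only [map_add, LinearMap.add_apply, hx, hy]
  exact h (Uq.comul q u)

/-- The component along `v₀` of `V 1` retains all coordinates but the last, and the last is seen
along `v₁`, where the factor is `q ^ (m - m) = 1`. So every coordinate functional of `V (m + 1)` is
the restriction of a pure tensor. -/
theorem exists_tensorFun_embed (m : ℕ) (i : Fin (m + 2)) : ∃ (k : Fin 2) (l : Fin (m + 1)),
    ∀ f : V (m + 1), tensorFun (LinearMap.proj k) (LinearMap.proj l) (embed q m f) = f i := by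
  induction i using Fin.lastCases with
  | last => exact ⟨1, Fin.last m, fun f => by simp [embed_apply, tensorFun]⟩
  | cast i => exact ⟨0, i, fun f => by simp [embed_apply, tensorFun]⟩

end V

/-- The matrix coefficients of `V (m + 1)` are combinations of products of matrix coefficients of
`V 1` and `V m`. -/
theorem exists_matrixCoeff_succ {q : ℂˣ} (hq : ∀ n : ℕ, 0 < n → q ^ n ≠ 1) (m : ℕ)
    (i : Fin (m + 2)) (v : V (m + 1)) : ∃ (k : Fin 2) (φ : Module.Dual ℂ (V m)) (w₀ w₁ : V m),
      WithConv.toConv (matrixCoeff q (m + 1) (LinearMap.proj i) v) =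
        stdCoeff q k 0 * WithConv.toConv (matrixCoeff q m φ w₀) +
          stdCoeff q k 1 * WithConv.toConv (matrixCoeff q m φ w₁) := by
  obtain ⟨k, l, h⟩ := V.exists_tensorFun_embed (q := q) m i
  -- The vectors `w₀`, `w₁` are the two components of `embed q m v`.
  refine ⟨k, LinearMap.proj l, fun k => v k.castSucc,
    fun k => (q : ℂ) ^ ((k : ℤ) - m) * v k.succ, ?_⟩
  ext u
  have := h (V.rep q (m + 1) u v)
  rw [V.embed_rep hq, V.embed_apply, map_add, map_add, ← V.matrixCoeff_mul,
      ← V.matrixCoeff_mul] at this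
  exact this.symm

/-! ### The dimension count in each degree -/

/-- The linear map underlying the pairing of `O_q(Mat₂)` with `U_q(sl₂)`. -/
def matPairingₗ (q : ℂˣ) : OqMat2 q →ₗ[ℂ] Module.Dual ℂ (Uq q) :=
  (WithConv.linearEquiv ℂ (Uq q →ₗ[ℂ] ℂ)).toLinearMap ∘ₗ (matPairing q).toLinearMap

/-- The span of the matrix coefficients of the modules `V m` with `m ≤ n` in the dominance
ordering. -/
def coeffFiltration (q : ℂˣ) (n : ℤ) : Submodule ℂ (Module.Dual ℂ (Uq q)) :=
  ⨆ (m : ℕ) (_ : DominanceLE m n), coeffSpace q m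

theorem coeffFiltration_eq_span (n : ℤ) :
    coeffFiltration q n = Submodule.span ℂ (basisCoeff q '' {p | DominanceLE p.1 n}) := by
  simp only [coeffFiltration, span_basisCoeff, ← Submodule.span_iUnion, ← Set.image_iUnion]
  congr 2
  ext p
  simp

theorem dominanceLE_natCast_iff {m n : ℕ} :
    DominanceLE m n ↔ m ∈ (Finset.range (n + 1)).filter fun m => Even (n - m) := by
  rw [Finset.mem_filter, Finset.mem_range]
  constructor
  · rintro ⟨k, hk⟩
    exact ⟨by omega, k, by omega⟩
  · rintro ⟨h, k, hk⟩
    exact ⟨k, by omega⟩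

/-- The induction goes by steps of two, since parity is fixed: two uses of Pascal's rule give the
increment `(n + 4).choose 2 + (n + 3).choose 2 = (n + 3) ^ 2`. -/
theorem sum_sq_eq_choose (n : ℕ) :
    ∑ m ∈ (Finset.range (n + 1)).filter (fun m => Even (n - m)), (m + 1) * (m + 1) =
      (n + 3).choose 3 := by
  induction n using Nat.twoStepInduction with
  | zero => rfl
  | one => rfl
  | more n ih _ =>
    have h : (Finset.range (n + 2 + 1)).filter (fun m => Even (n + 2 - m)) =
        insert (n + 2) ((Finset.range (n + 1)).filter fun m => Even (n - m)) := by
      ext m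
      simp only [Finset.mem_filter, Finset.mem_range, Finset.mem_insert]
      constructor
      · rintro ⟨h, k, hk⟩
        by_cases hm : m = n + 2
        · exact Or.inl hm
        · exact Or.inr ⟨by omega, k - 1, by omega⟩
      · rintro (rfl | ⟨h, k, hk⟩)
        · simp
        · exact ⟨by omega, k + 1, by omega⟩
    rw [h, Finset.sum_insert (by simp), ih]
    have h2 (k : ℕ) : (k + 1).choose 2 * 2 = (k + 1) * k := by
      rw [Nat.choose_two_right, Nat.add_sub_cancel]
      exact Nat.div_mul_cancel (by rw [mul_comm]; exact (Nat.even_mul_succ_self k).two_dvd)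
    have e1 : (n + 5).choose 3 = (n + 4).choose 2 + (n + 4).choose 3 := Nat.choose_succ_succ _ _
    have e2 : (n + 4).choose 3 = (n + 3).choose 2 + (n + 3).choose 3 := Nat.choose_succ_succ _ _
    have e3 := h2 (n + 3)
    have e4 := h2 (n + 2)
    have e5 : n + 2 + 3 = n + 5 := rfl
    rw [e5]
    nlinarith

theorem finrank_coeffFiltration (hq : ∀ n : ℕ, 0 < n → q ^ n ≠ 1) (n : ℕ) :
    Module.finrank ℂ (coeffFiltration q n) = (n + 3).choose 3 := by
  classical
  let s : Finset (Σ m : ℕ, Fin (m + 1) × Fin (m + 1)) :=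
    ((Finset.range (n + 1)).filter fun m => Even (n - m)).sigma fun _ => Finset.univ
  have hs : {p : Σ m : ℕ, Fin (m + 1) × Fin (m + 1) | DominanceLE p.1 n} = s := by
    ext p
    simp only [Set.mem_ofPred_eq, dominanceLE_natCast_iff, s, Finset.coe_sigma, Set.mem_sigma_iff,
      Finset.mem_coe, Finset.mem_univ, and_true]
  have hli : LinearIndependent ℂ fun p : s => basisCoeff q p :=
    (linearIndependent_basisCoeff hq).comp _ Subtype.val_injective
  rw [coeffFiltration_eq_span, hs, Set.image_eq_range]
  refine (finrank_span_eq_card hli).trans ?_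
  rw [Fintype.card_coe, Finset.card_sigma, ← sum_sq_eq_choose]
  simp

theorem matPairingₗ_apply (x : OqMat2 q) : matPairingₗ q x = (matPairing q x).ofConv := rfl

theorem matPairingₗ_qdet_mul (x : OqMat2 q) :
    matPairingₗ q (OqMat2.qdet q * x) = matPairingₗ q x := by
  rw [matPairingₗ_apply, map_mul, matPairing_qdet, one_mul, matPairingₗ_apply]

theorem stdCoeff_eq_matPairing (i j : Fin 2) :
    ∃ g, stdCoeff q i j = matPairing q (OqMat2.gen q g) := by
  have h (g) : matPairing q (OqMat2.gen q g) = pairingGen q g := by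
    rw [matPairing, OqMat2.lift_gen]
  simp only [h]
  fin_cases i <;> fin_cases j
  exacts [⟨.a, rfl⟩, ⟨.b, rfl⟩, ⟨.c, rfl⟩, ⟨.d, rfl⟩]

theorem rep_zero (q : ℂˣ) :
    V.rep q 0 = (Algebra.ofId ℂ (Module.End ℂ (V 0))).comp (Uq.counit q) := by
  apply Uq.hom_ext
  intro x
  refine LinearMap.ext fun f => funext fun i => ?_
  rw [V.rep_gen, AlgHom.comp_apply, Uq.counit_gen, Algebra.ofId_apply, Module.algebraMap_end_apply]
  fin_cases i
  cases x <;> simp [V.opGen, V.opE_apply, V.opF_apply, V.opK_apply, V.opKinv_apply, Uq.counitGen]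

/-- Coefficients of `V 0` are multiples of the counit, the convolution unit. Each passage from `V m`
to `V (m + 1)` multiplies by a generator on the left. -/
theorem coeffSpace_le_map_matPairingₗ (hq : ∀ n : ℕ, 0 < n → q ^ n ≠ 1) (m : ℕ) :
    coeffSpace q m ≤ (OqMat2.homogeneous q m).map (matPairingₗ q) := by
  induction m with
  | zero =>
    rw [coeffSpace, Submodule.span_le]
    rintro _ ⟨φ, v, rfl⟩
    refine ⟨φ v • 1, Submodule.smul_mem _ _ OqMat2.one_mem_homogeneous, ?_⟩
    ext u
    rw [matrixCoeff_apply, rep_zero q, AlgHom.comp_apply, Algebra.ofId_apply,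
      Module.algebraMap_end_apply, map_smul, map_smul, matPairingₗ_apply, map_one, smul_eq_mul,
      mul_comm]
    rfl
  | succ m ih =>
    rw [span_basisCoeff, Submodule.span_le]
    rintro _ ⟨⟨_, i, j⟩, rfl, rfl⟩
    obtain ⟨k, φ, w₀, w₁, h⟩ := exists_matrixCoeff_succ hq m i (Pi.single j 1)
    obtain ⟨x, hx, hx'⟩ := ih (Submodule.subset_span ⟨φ, w₀, rfl⟩)
    obtain ⟨y, hy, hy'⟩ := ih (Submodule.subset_span ⟨φ, w₁, rfl⟩)
    obtain ⟨g, hg⟩ := stdCoeff_eq_matPairing (q := q) k 0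
    obtain ⟨g', hg'⟩ := stdCoeff_eq_matPairing (q := q) k 1
    refine ⟨_, add_mem (OqMat2.gen_mul_mem g hx) (OqMat2.gen_mul_mem g' hy), ?_⟩
    rw [← hx', ← hy', hg, hg'] at h
    rw [matPairingₗ_apply, map_add, map_mul, map_mul]
    exact congrArg WithConv.ofConv h.symm

/-- Multiplication by `D_q` raises the degree by two without changing the functional. -/
theorem map_homogeneous_le (n k : ℕ) : (OqMat2.homogeneous q n).map (matPairingₗ q) ≤
    (OqMat2.homogeneous q (n + 2 * k)).map (matPairingₗ q) := by
  induction k with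
  | zero => rfl
  | succ k ih =>
    refine ih.trans ?_
    rintro _ ⟨x, hx, rfl⟩
    exact ⟨_, OqMat2.qdet_mul_mem hx, matPairingₗ_qdet_mul x⟩

theorem coeffFiltration_le_map (hq : ∀ n : ℕ, 0 < n → q ^ n ≠ 1) (n : ℕ) :
    coeffFiltration q n ≤ (OqMat2.homogeneous q n).map (matPairingₗ q) := by
  refine iSup₂_le fun m hm => (coeffSpace_le_map_matPairingₗ hq m).trans ?_
  obtain ⟨k, hk⟩ := hm
  obtain rfl : n = m + 2 * k := by omega
  exact map_homogeneous_le m k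

/-- The chain closes up: the degree piece has dimension at most the binomial, which is the dimension
of the coefficient space, which is contained in the image. Hence the pairing is injective in each
degree. -/
theorem finrank_homogeneous (hq : ∀ n : ℕ, 0 < n → q ^ n ≠ 1) (n : ℕ) :
    Module.finrank ℂ (OqMat2.homogeneous q n) =
      Module.finrank ℂ ((OqMat2.homogeneous q n).map (matPairingₗ q)) := by
  apply le_antisymm _ (Submodule.finrank_map_le _ _)
  refine (OqMat2.finrank_homogeneous_le q n).trans ?_
  rw [← finrank_coeffFiltration hq]
  exact Submodule.finrank_mono (coeffFiltration_le_map hq n)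

theorem coeffFiltration_eq_map (hq : ∀ n : ℕ, 0 < n → q ^ n ≠ 1) (n : ℕ) :
    coeffFiltration q n = (OqMat2.homogeneous q n).map (matPairingₗ q) := by
  apply Submodule.eq_of_le_of_finrank_le (coeffFiltration_le_map hq n)
  rw [finrank_coeffFiltration hq]
  exact (Submodule.finrank_map_le _ _).trans (OqMat2.finrank_homogeneous_le q n)

theorem eq_zero_of_matPairingₗ_eq_zero (hq : ∀ n : ℕ, 0 < n → q ^ n ≠ 1) {n : ℕ} {x : OqMat2 q}
    (hx : x ∈ OqMat2.homogeneous q n) (h : matPairingₗ q x = 0) : x = 0 := by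
  have hr := ((matPairingₗ q).domRestrict (OqMat2.homogeneous q n)).finrank_range_add_finrank_ker
  rw [LinearMap.range_domRestrict, ← finrank_homogeneous hq, Nat.add_eq_left,
    Submodule.finrank_eq_zero] at hr
  have : (⟨x, hx⟩ : OqMat2.homogeneous q n) ∈
      LinearMap.ker ((matPairingₗ q).domRestrict (OqMat2.homogeneous q n)) := h
  rw [hr, Submodule.mem_bot] at this
  exact congrArg Subtype.val this

/-- The highest weights involved have opposite parities, so disjoint parts of a linearly independent
family span the two spaces. -/
theorem disjoint_coeffFiltration (hq : ∀ n : ℕ, 0 < n → q ^ n ≠ 1) (n : ℤ) :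
    Disjoint (coeffFiltration q n) (coeffFiltration q (n + 1)) := by
  rw [coeffFiltration_eq_span, coeffFiltration_eq_span]
  apply (linearIndependent_basisCoeff hq).disjoint_span_image
  rw [Set.disjoint_left]
  rintro p ⟨k, hk⟩ ⟨l, hl⟩
  omega

/-! ### Injectivity of the pairing and the Peter–Weyl filtration -/

theorem exists_mk_homogeneous (y : OqSL2 q) : ∃ n : ℕ, y ∈
    (OqMat2.homogeneous q n).map (OqSL2.mk q).toLinearMap ⊔
      (OqMat2.homogeneous q (n + 1)).map (OqSL2.mk q).toLinearMap := by
  let R (n : ℕ) : Submodule ℂ (OqSL2 q) :=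
    (OqMat2.homogeneous q n).map (OqSL2.mk q).toLinearMap
  -- As `D_q` becomes `1`, images grow along each parity, so two consecutive degrees absorb all
  -- lower ones.
  have hR (n : ℕ) : R n ≤ R (n + 2) := by
    rintro _ ⟨x, hx, rfl⟩
    exact ⟨_, OqMat2.qdet_mul_mem hx, by simp [OqSL2.mk_qdet]⟩
  have hmono : Monotone fun n => R n ⊔ R (n + 1) :=
    monotone_nat_of_le_succ fun n => sup_le ((hR n).trans le_sup_right) le_sup_left
  obtain ⟨x, rfl⟩ := RingQuot.mkAlgHom_surjective ℂ (DetRel q) y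
  have hx : x ∈ ⨆ n, OqMat2.homogeneous q n := by rw [OqMat2.iSup_homogeneous]; trivial
  change ∃ n, OqSL2.mk q x ∈ R n ⊔ R (n + 1)
  induction hx using Submodule.iSup_induction' with
  | mem n x hx => exact ⟨n, Submodule.mem_sup_left ⟨x, hx, rfl⟩⟩
  | zero => exact ⟨0, by rw [map_zero]; exact zero_mem _⟩
  | add x y _ _ hx hy =>
    obtain ⟨n, hn⟩ := hx
    obtain ⟨k, hk⟩ := hy
    refine ⟨max n k, ?_⟩
    rw [map_add]
    exact add_mem (hmono (le_max_left n k) hn) (hmono (le_max_right n k) hk)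

theorem pairing_mk (x : OqMat2 q) : pairing q (OqSL2.mk q x) = matPairing q x :=
  OqSL2.lift_mk _ _ _

/-- The pairing of `O_q(SL₂)` with `U_q(sl₂)` is nondegenerate on the left. -/
theorem pairing_injective (hq : ∀ n : ℕ, 0 < n → q ^ n ≠ 1) : Function.Injective (pairing q) := by
  rw [injective_iff_map_eq_zero]
  intro y hy
  obtain ⟨n, hn⟩ := exists_mk_homogeneous y
  obtain ⟨_, ⟨x, hx, rfl⟩, _, ⟨x', hx', rfl⟩, rfl⟩ := Submodule.mem_sup.1 hn
  have h : matPairingₗ q x + matPairingₗ q x' = 0 := by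
    rw [← map_add, matPairingₗ_apply, ← pairing_mk, map_add (OqSL2.mk q)]
    exact congrArg WithConv.ofConv hy
  have h1 : matPairingₗ q x ∈ coeffFiltration q n := by
    rw [coeffFiltration_eq_map hq]; exact ⟨x, hx, rfl⟩
  have h2 : matPairingₗ q x' ∈ coeffFiltration q ((n : ℤ) + 1) := by
    have := coeffFiltration_eq_map hq (n + 1)
    push_cast at this
    rw [this]; exact ⟨x', hx', rfl⟩
  -- The functional of `x` is minus that of `x'`, so it lies in both parities.
  have h3 : matPairingₗ q x = 0 := by
    refine Submodule.disjoint_def.1 (disjoint_coeffFiltration hq n) _ h1 ?_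
    rw [eq_neg_of_add_eq_zero_left h]
    exact neg_mem h2
  rw [h3, zero_add] at h
  rw [eq_zero_of_matPairingₗ_eq_zero hq hx h3, eq_zero_of_matPairingₗ_eq_zero hq hx' h]
  simp

/-- The Peter–Weyl filtration of `O_q(SL₂)` is the filtration by degree. -/
theorem peterWeyl_eq_map (hq : ∀ n : ℕ, 0 < n → q ^ n ≠ 1) (n : ℕ) :
    peterWeyl q n = (OqMat2.homogeneous q n).map (OqSL2.mk q).toLinearMap := by
  ext y
  change (pairing q y).ofConv ∈ coeffFiltration q n ↔ _
  rw [coeffFiltration_eq_map hq]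
  constructor
  · rintro ⟨x, hx, h⟩
    refine ⟨x, hx, pairing_injective hq ?_⟩
    rw [AlgHom.toLinearMap_apply, pairing_mk]
    exact congrArg WithConv.toConv h
  · rintro ⟨x, hx, rfl⟩
    refine ⟨x, hx, ?_⟩
    rw [AlgHom.toLinearMap_apply, pairing_mk, matPairingₗ_apply]

theorem eq_zero_of_mk_eq_zero (hq : ∀ n : ℕ, 0 < n → q ^ n ≠ 1) {n : ℕ} {x : OqMat2 q}
    (hx : x ∈ OqMat2.homogeneous q n) (h : OqSL2.mk q x = 0) : x = 0 := by
  apply eq_zero_of_matPairingₗ_eq_zero hq hx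
  rw [matPairingₗ_apply, ← pairing_mk, h, map_zero]
  rfl

/-! ### Images of injective bialgebra homomorphisms -/

/-- The transport of a coalgebra structure along a linear equivalence. -/
abbrev coalgebraOfLinearEquiv {A B : Type*} [AddCommGroup A] [Module ℂ A] [Coalgebra ℂ A]
    [AddCommGroup B] [Module ℂ B] (E : A ≃ₗ[ℂ] B) : Coalgebra ℂ B where
  comul := TensorProduct.map E.toLinearMap E.toLinearMap ∘ₗ Coalgebra.comul ∘ₗ E.symm.toLinearMap
  counit := Coalgebra.counit ∘ₗ E.symm.toLinearMap
  coassoc := by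
    ext x
    -- The two sides of coassociativity for `B` are the images of those for `A` under `E ⊗ (E ⊗ E)`.
    have h₁ (t : A ⊗[ℂ] A) : TensorProduct.assoc ℂ B B B (LinearMap.rTensor B
        (TensorProduct.map E.toLinearMap E.toLinearMap ∘ₗ Coalgebra.comul ∘ₗ E.symm.toLinearMap)
        (TensorProduct.map E.toLinearMap E.toLinearMap t)) =
        TensorProduct.map E.toLinearMap (TensorProduct.map E.toLinearMap E.toLinearMap)
          (TensorProduct.assoc ℂ A A A (LinearMap.rTensor A Coalgebra.comul t)) := by
      induction t with
      | zero => simp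
      | tmul a b =>
        simp only [TensorProduct.map_tmul, LinearMap.rTensor_tmul, LinearMap.comp_apply,
          LinearEquiv.coe_coe, LinearEquiv.symm_apply_apply]
        generalize Coalgebra.comul (R := ℂ) a = s
        induction s with
        | zero => simp
        | tmul c d => simp
        | add s t hs ht => simp only [map_add, TensorProduct.add_tmul, hs, ht]
      | add s t hs ht => simp only [map_add, hs, ht]
    have h₂ (t : A ⊗[ℂ] A) : LinearMap.lTensor B
        (TensorProduct.map E.toLinearMap E.toLinearMap ∘ₗ Coalgebra.comul ∘ₗ E.symm.toLinearMap)
        (TensorProduct.map E.toLinearMap E.toLinearMap t) =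
        TensorProduct.map E.toLinearMap (TensorProduct.map E.toLinearMap E.toLinearMap)
          (LinearMap.lTensor A Coalgebra.comul t) := by
      induction t with
      | zero => simp
      | tmul a b => simp
      | add s t hs ht => simp only [map_add, hs, ht]
    exact (h₁ _).trans ((congrArg _ (Coalgebra.coassoc_apply (E.symm x))).trans (h₂ _).symm)
  rTensor_counit_comp_comul := by
    ext x
    have h (t : A ⊗[ℂ] A) : LinearMap.rTensor B (Coalgebra.counit ∘ₗ E.symm.toLinearMap)
        (TensorProduct.map E.toLinearMap E.toLinearMap t) =
        LinearMap.lTensor ℂ E.toLinearMap (LinearMap.rTensor A Coalgebra.counit t) := by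
      induction t with
      | zero => simp
      | tmul a b => simp
      | add s t hs ht => simp only [map_add, hs, ht]
    refine (h _).trans ?_
    rw [LinearMap.comp_apply, Coalgebra.rTensor_counit_comul]
    simp
  lTensor_counit_comp_comul := by
    ext x
    have h (t : A ⊗[ℂ] A) : LinearMap.lTensor B (Coalgebra.counit ∘ₗ E.symm.toLinearMap)
        (TensorProduct.map E.toLinearMap E.toLinearMap t) =
        LinearMap.rTensor ℂ E.toLinearMap (LinearMap.lTensor A Coalgebra.counit t) := by
      induction t with
      | zero => simp
      | tmul a b => simp
      | add s t hs ht => simp only [map_add, hs, ht]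
    refine (h _).trans ?_
    rw [LinearMap.comp_apply, Coalgebra.lTensor_counit_comul]
    simp

namespace SubBialgebra

variable {A B : Type*} [Ring A] [Bialgebra ℂ A] [Ring B] [Bialgebra ℂ B] (f : A →ₐc[ℂ] B)
  (hf : Function.Injective f)

/-- The image of an injective homomorphism of bialgebras, as a sub-bialgebra. -/
def ofInjective : SubBialgebra B where
  toSubalgebra := (f : A →ₐ[ℂ] B).range
  coalgebra := coalgebraOfLinearEquiv (AlgEquiv.ofInjective (f : A →ₐ[ℂ] B) hf).toLinearEquiv
  map_comul x := by
    obtain ⟨a, rfl⟩ := (AlgEquiv.ofInjective (f : A →ₐ[ℂ] B) hf).surjective x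
    refine Eq.trans ?_ (CoalgHomClass.map_comp_comul_apply f a)
    let E := (AlgEquiv.ofInjective (f : A →ₐ[ℂ] B) hf).toLinearEquiv
    change TensorProduct.map (f : A →ₐ[ℂ] B).range.val.toLinearMap
      (f : A →ₐ[ℂ] B).range.val.toLinearMap (TensorProduct.map E.toLinearMap E.toLinearMap
        (Coalgebra.comul (R := ℂ) (E.symm (E a)))) = _
    rw [E.symm_apply_apply, ← LinearMap.comp_apply, ← TensorProduct.map_comp]
    rfl
  counit_coe x := by
    obtain ⟨a, rfl⟩ := (AlgEquiv.ofInjective (f : A →ₐ[ℂ] B) hf).surjective x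
    refine Eq.trans ?_ (CoalgHomClass.counit_comp_apply f a).symm
    exact congrArg _ ((AlgEquiv.ofInjective (f : A →ₐ[ℂ] B) hf).symm_apply_apply a)

/-- An injective homomorphism of bialgebras is an isomorphism onto its image. -/
def equivOfInjective : A ≃ₐc[ℂ] (ofInjective f hf).toSubalgebra :=
  BialgEquiv.ofAlgEquiv (AlgEquiv.ofInjective (f : A →ₐ[ℂ] B) hf)
    (by
      refine AlgHom.ext fun a => ?_
      exact congrArg (Coalgebra.counit (R := ℂ))
        ((AlgEquiv.ofInjective (f : A →ₐ[ℂ] B) hf).symm_apply_apply a))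
    (by
      refine AlgHom.ext fun a => ?_
      have := congrArg (Coalgebra.comul (R := ℂ))
        ((AlgEquiv.ofInjective (f : A →ₐ[ℂ] B) hf).symm_apply_apply a)
      exact congrArg (TensorProduct.map _ _) this.symm)

end SubBialgebra

/-! ### The homomorphism to `O_q(SL₂)[z]` and its image -/

/-- The homomorphism `O_q(Mat₂) → O_q(SL₂)[z]` that multiplies each generator by `z`. -/
def toOqSL2z (q : ℂˣ) : OqMat2 q →ₐ[ℂ] OqSL2z q := by
  refine OqMat2.lift (fun g => AddMonoidAlgebra.single 1 (OqSL2.mk q (OqMat2.gen q g)))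
    ?_ ?_ ?_ ?_ ?_ (sub_eq_iff_eq_add'.2 ?_) <;>
  simp only [AddMonoidAlgebra.single_mul_single, AddMonoidAlgebra.smul_single, ← map_mul,
    ← map_smul, ← AddMonoidAlgebra.single_add, ← map_add]
  · rw [OqMat2.a_mul_b]
  · rw [OqMat2.a_mul_c]
  · rw [OqMat2.c_mul_b]
  · rw [OqMat2.b_mul_d]
  · rw [OqMat2.c_mul_d]
  · rw [OqMat2.a_mul_d]

theorem toOqSL2z_gen (g : MatGen) : toOqSL2z q (OqMat2.gen q g) =
    AddMonoidAlgebra.single 1 (OqSL2.mk q (OqMat2.gen q g)) := by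
  simp [toOqSL2z]

/-- The exponent of `z` records the degree. This turns statements about degree pieces into
statements about the Rees subspace. -/
theorem toOqSL2z_of_mem {n : ℕ} {x : OqMat2 q} (hx : x ∈ OqMat2.homogeneous q n) :
    toOqSL2z q x = AddMonoidAlgebra.single n (OqSL2.mk q x) := by
  induction hx using OqMat2.homogeneous_induction with
  | mon i j k l h =>
    simp [toOqSL2z_gen, AddMonoidAlgebra.single_mul_single, AddMonoidAlgebra.single_pow, ← h,
      add_assoc]
  | zero => simp
  | add x y _ _ hx hy => rw [map_add, hx, hy, map_add, AddMonoidAlgebra.single_add]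
  | smul r x _ hx => rw [map_smul, hx, map_smul, AddMonoidAlgebra.smul_single]

theorem OqSL2.comul_mk_gen (g : MatGen) : Coalgebra.comul (R := ℂ) (OqSL2.mk q (OqMat2.gen q g)) =
    TensorProduct.map (OqSL2.mk q).toLinearMap (OqSL2.mk q).toLinearMap (OqMat2.comulGen q g) := by
  change OqSL2.comul q _ = _
  rw [OqSL2.comul, OqSL2.lift_mk, AlgHom.comp_apply, OqMat2.comul_gen]
  rfl

/-- The homomorphism `toOqSL2z` as a homomorphism of bialgebras. -/
def toOqSL2zBialgHom (q : ℂˣ) : OqMat2 q →ₐc[ℂ] OqSL2z q :=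
  BialgHom.ofAlgHom (toOqSL2z q)
    (by
      apply OqMat2.hom_ext
      intro g
      change Coalgebra.counit (R := ℂ) (toOqSL2z q (OqMat2.gen q g)) =
        OqMat2.counit q (OqMat2.gen q g)
      rw [toOqSL2z_gen, AddMonoidAlgebra.counit_single]
      change OqSL2.counit q _ = _
      rw [OqSL2.counit, OqSL2.lift_mk])
    (by
      apply OqMat2.hom_ext
      intro g
      change Algebra.TensorProduct.map _ _ (OqMat2.comul q (OqMat2.gen q g)) =
        Coalgebra.comul (R := ℂ) (toOqSL2z q (OqMat2.gen q g))
      rw [toOqSL2z_gen, AddMonoidAlgebra.comul_single, OqSL2.comul_mk_gen, OqMat2.comul_gen]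
      cases g <;> simp [OqMat2.comulGen, toOqSL2z_gen])

theorem toOqSL2z_qdet : toOqSL2z q (OqMat2.qdet q) = AddMonoidAlgebra.single 2 1 := by
  have h : OqMat2.qdet q ∈ OqMat2.homogeneous q 2 := by
    simpa using OqMat2.qdet_mul_mem (OqMat2.one_mem_homogeneous (q := q))
  rw [toOqSL2z_of_mem h, OqSL2.mk_qdet]

theorem toOqSL2z_injective (hq : ∀ n : ℕ, 0 < n → q ^ n ≠ 1) :
    Function.Injective (toOqSL2z q) := by
  rw [injective_iff_map_eq_zero]
  intro x h
  have hx : x ∈ ⨆ n, OqMat2.homogeneous q n := by rw [OqMat2.iSup_homogeneous]; trivial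
  -- Any decomposition into degree pieces will do. The coefficient of `z ^ n` is the class of `f n`
  -- in `O_q(SL₂)`, and the quotient map is injective on each degree.
  obtain ⟨f, hf, rfl⟩ := (Submodule.mem_iSup_iff_exists_finsupp _ _).1 hx
  refine Finset.sum_eq_zero fun n _ => eq_zero_of_mk_eq_zero hq (hf n) ?_
  have hn := congrArg (fun p : OqSL2z q => p.coeff n) h
  simp only [Finsupp.sum, map_sum, toOqSL2z_of_mem (hf _)] at hn
  by_cases h0 : f n = 0
  · rw [h0, map_zero]
  · exact (by simpa [Finsupp.single_apply] using hn : ¬f n = 0 → _) h0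

/-- Both sides consist of sums of terms `x̄ zⁿ` with `x` of degree `n`, by `peterWeyl_eq_map`. -/
theorem range_toOqSL2z (hq : ∀ n : ℕ, 0 < n → q ^ n ≠ 1) :
    Subalgebra.toSubmodule (toOqSL2z q).range = rees q := by
  apply le_antisymm
  · rintro _ ⟨x, rfl⟩
    have hx : x ∈ ⨆ n, OqMat2.homogeneous q n := by rw [OqMat2.iSup_homogeneous]; trivial
    change toOqSL2z q x ∈ rees q
    induction hx using Submodule.iSup_induction' with
    | mem n x hx =>
      intro k
      rw [toOqSL2z_of_mem hx]
      by_cases h : n = k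
      · subst h
        rw [peterWeyl_eq_map hq]
        exact ⟨x, hx, by simp⟩
      · simp [h]
    | zero => rw [map_zero]; exact zero_mem _
    | add x y _ _ hx hy => rw [map_add]; exact add_mem hx hy
  · intro p hp
    have : p = ∑ n ∈ p.coeff.support, AddMonoidAlgebra.single n (p.coeff n) :=
      (AddMonoidAlgebra.sum_coeff_single p).symm
    rw [this]
    refine sum_mem fun n _ => ?_
    have h := hp n
    rw [peterWeyl_eq_map hq] at h
    obtain ⟨x, hx, h⟩ := h
    exact ⟨x, (toOqSL2z_of_mem hx).trans (congrArg _ h)⟩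

end QuantumSL2
end

theorem mainTheorem5 (q : ℂˣ) (hq : ∀ n : ℕ, 0 < n → q ^ n ≠ 1) :
    ∃ S : QuantumSL2.SubBialgebra (QuantumSL2.OqSL2z q),
      Subalgebra.toSubmodule S.toSubalgebra = QuantumSL2.rees q ∧
      ∃ e : S.toSubalgebra ≃ₐc[ℂ] QuantumSL2.OqMat2 q,
        ((e.symm (QuantumSL2.OqMat2.qdet q) : S.toSubalgebra) : QuantumSL2.OqSL2z q) =
          AddMonoidAlgebra.single 2 (1 : QuantumSL2.OqSL2 q) := by
  refine ⟨QuantumSL2.SubBialgebra.ofInjective (QuantumSL2.toOqSL2zBialgHom q)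
    (QuantumSL2.toOqSL2z_injective hq), QuantumSL2.range_toOqSL2z hq,
    (QuantumSL2.SubBialgebra.equivOfInjective _ _).symm, ?_⟩
  exact QuantumSL2.toOqSL2z_qdet
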